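/- Fix a constant $\gamma>0$ and real numbers $Z\ge 0$ and $N\ge 0$. For nonnegative $\rho\in L^{5/3}(\mathbb{R}^3)$ put $$D[\rho]=\frac12\int_{\mathbb{R}^3}\int_{\mathbb{R}^3}\frac{\rho(x)\rho(y)}{|x-y|}\,dx\,dy\in[0,\infty],$$ and let $$\mathcal I=\{\rho\in L^{5/3}(\mathbb{R}^3):\rho\ge0,\ D[\rho]<\infty\},\qquad \mathcal I_N=\Bigl\{\rho\in\mathcal I:\int_{\mathbb{R}^3}\rho\le N\Bigr\},\qquad \mathcal I_{\partial N}=\Bigl\{\rho\in\mathcal I_N:\int_{\mathbb{R}^3}\rho=N\Bigr\}.$$ On $\mathcal I$ consider the Thomas--Fermi functional $$\mathcal E_Z(\rho)=\int_{\mathbb{R}^3}\Bigl(\frac35\gamma\,\rho(x)^{5/3}-\frac{Z}{|x|}\rho(x)\Bigr)dx+D[\rho].$$ Then $\mathcal E_Z$ has a unique minimizer $\rho_Z$ on $\mathcal I$, and the following hold. 1. If $N\le Z$, then $\mathcal E_Z$ has a unique minimizer on $\mathcal I_N$, and it lies in $\mathcal I_{\partial N}$, i.e. it has mass exactly $N$.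 2. If $N>Z$, then $\rho_Z$ is the unique minimizer of $\mathcal E_Z$ on $\mathcal I_N$, and it lies in $\mathcal I_{\partial Z}$, i.e. $\int_{\mathbb{R}^3}\rho_Z=Z$. 3. If $N>Z$, then $\mathcal E_Z$ has no minimizer on $\mathcal I_{\partial N}$, although $\inf_{\mathcal I_{\partial N}}\mathcal E_Z=\inf_{\mathcal I_N}\mathcal E_Z>-\infty$. -/

import Mathlib

open MeasureTheory
open scoped ENNReal

namespace ThomasFermi

/-- Three-dimensional Euclidean space. -/
abbrev Space : Type := EuclideanSpace ℝ (Fin 3)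

/-- Real-valued `L^{5/3}` functions on `ℝ³` (modulo a.e. equality). -/
abbrev Density : Type := Lp ℝ (5 / 3 : ℝ≥0∞) (volume : Measure Space)

/-- The Coulomb energy `D[ρ] = ½ ∬ ρ(x) ρ(y) / |x - y| dx dy` of a nonnegative density,
with values in `[0, ∞]`. The diagonal `x = y` is a null set. -/
noncomputable def coulomb (ρ : Density) : ℝ≥0∞ :=
  2⁻¹ * ∫⁻ x : Space, ∫⁻ y : Space, ENNReal.ofReal (ρ x * ρ y / ‖x - y‖)

/-- The total mass `∫ ρ` of a nonnegative density, with values in `[0, ∞]`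
(`L^{5/3}` functions need not be integrable). -/
noncomputable def mass (ρ : Density) : ℝ≥0∞ :=
  ∫⁻ x : Space, ENNReal.ofReal (ρ x)

/-- `𝓘`: the nonnegative densities in `L^{5/3}(ℝ³)` with finite Coulomb energy. -/
def admissible : Set Density :=
  {ρ | (∀ᵐ x : Space, 0 ≤ ρ x) ∧ coulomb ρ < ∞}

/-- `𝓘_N`: the densities in `𝓘` of mass at most `N`. -/
def admissibleLE (N : ℝ) : Set Density :=
  {ρ | ρ ∈ admissible ∧ mass ρ ≤ ENNReal.ofReal N}

/-- `𝓘_{∂N}`: the densities in `𝓘_N` of mass exactly `N`. -/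
def admissibleEq (N : ℝ) : Set Density :=
  {ρ | ρ ∈ admissibleLE N ∧ mass ρ = ENNReal.ofReal N}

/-- The Thomas–Fermi functional of an atom of nuclear charge `Z`, with kinetic constant `γ`;
it is used on `𝓘` only, where all three terms are finite. -/
noncomputable def energy (γ Z : ℝ) (ρ : Density) : ℝ :=
  (∫ x : Space, (3 / 5 * γ * (ρ x) ^ (5 / 3 : ℝ) - Z / ‖x‖ * ρ x)) + (coulomb ρ).toReal

/-- `ρ` is a minimizer on `S` of the Thomas–Fermi functional. -/
def IsMinimizer (γ Z : ℝ) (S : Set Density) (ρ : Density) : Prop :=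
  ρ ∈ S ∧ ∀ σ ∈ S, energy γ Z ρ ≤ energy γ Z σ

end ThomasFermi

/-! The energy is the sum of a strictly convex kinetic term, a linear attraction and a convex
Coulomb term. Convexity of the last is positive definiteness of 1/|x - y|, read off from its
representation as a superposition of products of Gaussians (`two_mul_inter_le`). Strict convexity of
t^(5/3) is used in a quantitative form (`exists_uniform_convexity`): at bounded kinetic energy, two
near-minimizers are close in L^(5/3) (`norm_sub_rpow_le_energy`). This gives uniqueness, and it
makes minimizing sequences at bounded mass Cauchy in norm. Existence (`exists_isMinimizer`)
therefore needs completeness and lower semicontinuity under norm convergence, but no weak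
compactness.

The minimizer at mass at most N has mass min(N, Z) (`IsMinimizer.mass_eq`). Uniqueness makes it
radial. If its mass exceeded Z, some ball would hold charge at least Z but not all of it. By
Newton's theorem (`potential_radial`) this inner charge repels the outer charge at least as strongly
as the nucleus attracts it, so dropping the outer charge would save its kinetic energy: a
contradiction. If instead its mass m were below both N and Z, a uniformly charged ball of radius R
and small density ε could be added. To first order in ε the electrostatic gain is at least of order
(Z - m) R², while the kinetic cost is at most of order R, so a large R lowers the energy.

Hence for all N > Z the minimizers have mass Z and coincide, and truncation to balls compares them
with densities of infinite mass. At neutrality an extra charge N - Z spread over a huge ball costs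
arbitrarily little, so the infima over mass exactly N and mass at most N agree. A minimizer of mass
N would then be the one of mass Z. -/

namespace ThomasFermi

/-! ### Bilinear calculus of the Coulomb interaction -/

/-- The Coulomb kernel `1 / |w|`, with value `∞` at the origin. -/
noncomputable def kern (w : Space) : ℝ≥0∞ := ‖w‖ₑ⁻¹

/-- The Coulomb potential of `f`. -/
noncomputable def potential (f : Space → ℝ≥0∞) (x : Space) : ℝ≥0∞ := ∫⁻ y, f y * kern (x - y)

/-- The Coulomb interaction of two charge distributions. -/
noncomputable def inter (f g : Space → ℝ≥0∞) : ℝ≥0∞ := ∫⁻ x, f x * potential g x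

/-- The integral of `f ^ (5/3)`. -/
noncomputable def kin (f : Space → ℝ≥0∞) : ℝ≥0∞ := ∫⁻ x, f x ^ (5 / 3 : ℝ)

/-- The attraction of `f` by a unit charge at the origin. -/
noncomputable def attr (f : Space → ℝ≥0∞) : ℝ≥0∞ := ∫⁻ x, f x * kern x

/-- The Thomas–Fermi energy of an `ℝ≥0∞`-valued density. -/
noncomputable def tfEnergy (γ Z : ℝ) (f : Space → ℝ≥0∞) : ℝ :=
  3 / 5 * γ * (kin f).toReal - Z * (attr f).toReal + (inter f f).toReal / 2

@[fun_prop]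
lemma measurable_kern : Measurable kern := by
  unfold kern; fun_prop

lemma kern_neg (w : Space) : kern (-w) = kern w := by simp [kern]

lemma kern_sub_comm (x y : Space) : kern (x - y) = kern (y - x) := by
  rw [← kern_neg, neg_sub]

lemma measurable_potential {f : Space → ℝ≥0∞} (hf : Measurable f) : Measurable (potential f) := by
  unfold potential
  refine Measurable.lintegral_prod_right' (f := fun p : Space × Space => f p.2 * kern (p.1 - p.2)) ?_
  fun_prop

lemma inter_eq {f g : Space → ℝ≥0∞} (hg : Measurable g) :
    inter f g = ∫⁻ x, ∫⁻ y, f x * g y * kern (x - y) := by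
  unfold inter potential
  refine lintegral_congr fun x => ?_
  rw [← lintegral_const_mul _ (by fun_prop)]
  simp only [mul_assoc]

lemma inter_comm {f g : Space → ℝ≥0∞} (hf : Measurable f) (hg : Measurable g) :
    inter f g = inter g f := by
  rw [inter_eq hg, inter_eq hf, lintegral_lintegral_swap (by fun_prop)]
  refine lintegral_congr fun x => lintegral_congr fun y => ?_
  rw [kern_sub_comm, mul_comm (f y)]

lemma potential_add {f g : Space → ℝ≥0∞} (hf : Measurable f) (x : Space) :
    potential (f + g) x = potential f x + potential g x := by
  unfold potential
  rw [← lintegral_add_left (by fun_prop)]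
  simp [add_mul]

lemma inter_add_right {f g h : Space → ℝ≥0∞} (hf : Measurable f) (hg : Measurable g) :
    inter f (g + h) = inter f g + inter f h := by
  unfold inter
  rw [← lintegral_add_left (hf.fun_mul (measurable_potential hg))]
  refine lintegral_congr fun x => ?_
  rw [potential_add hg, mul_add]

lemma inter_add_left {f g h : Space → ℝ≥0∞} (hf : Measurable f) (hh : Measurable h) :
    inter (f + g) h = inter f h + inter g h := by
  unfold inter
  rw [← lintegral_add_left (hf.fun_mul (measurable_potential hh))]
  simp [add_mul]

lemma inter_add_add {f g : Space → ℝ≥0∞} (hf : Measurable f) (hg : Measurable g) :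
    inter (f + g) (f + g) = inter f f + 2 * inter f g + inter g g := by
  rw [inter_add_left hf (hf.add hg), inter_add_right hf hf, inter_add_right hg hf,
    inter_comm hg hf]
  ring

lemma potential_const_mul {f : Space → ℝ≥0∞} (hf : Measurable f) (c : ℝ≥0∞) (x : Space) :
    potential (fun y => c * f y) x = c * potential f x := by
  unfold potential
  rw [← lintegral_const_mul _ (by fun_prop)]
  simp [mul_assoc]

lemma inter_const_mul_right {f g : Space → ℝ≥0∞} (hf : Measurable f) (hg : Measurable g)
    (c : ℝ≥0∞) : inter f (fun y => c * g y) = c * inter f g := by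
  unfold inter
  rw [← lintegral_const_mul _ (hf.fun_mul (measurable_potential hg))]
  refine lintegral_congr fun x => ?_
  rw [potential_const_mul hg]; ring

lemma inter_const_mul_left {f g : Space → ℝ≥0∞} (hf : Measurable f) (hg : Measurable g)
    (c : ℝ≥0∞) : inter (fun y => c * f y) g = c * inter f g := by
  unfold inter
  rw [← lintegral_const_mul _ (hf.fun_mul (measurable_potential hg))]
  simp [mul_assoc]

lemma potential_mono {f g : Space → ℝ≥0∞} (h : f ≤ g) : potential f ≤ potential g :=
  fun _ => lintegral_mono fun y => mul_le_mul_left (h y) _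

lemma inter_mono {f f' g g' : Space → ℝ≥0∞} (h : f ≤ f') (h' : g ≤ g') :
    inter f g ≤ inter f' g' :=
  lintegral_mono fun x => mul_le_mul' (h x) (potential_mono h' x)

lemma potential_congr {f g : Space → ℝ≥0∞} (h : f =ᵐ[volume] g) : potential f = potential g := by
  funext x
  exact lintegral_congr_ae (h.mono fun y hy => by simp only [hy])

lemma inter_congr {f f' g g' : Space → ℝ≥0∞} (h : f =ᵐ[volume] f') (h' : g =ᵐ[volume] g') :
    inter f g = inter f' g' := by
  unfold inter
  rw [potential_congr h']
  exact lintegral_congr_ae (h.mono fun y hy => by simp only [hy])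

lemma kin_congr {f g : Space → ℝ≥0∞} (h : f =ᵐ[volume] g) : kin f = kin g :=
  lintegral_congr_ae (h.mono fun y hy => by simp only [hy])

lemma attr_congr {f g : Space → ℝ≥0∞} (h : f =ᵐ[volume] g) : attr f = attr g :=
  lintegral_congr_ae (h.mono fun y hy => by simp only [hy])

lemma attr_add {f g : Space → ℝ≥0∞} (hf : Measurable f) : attr (f + g) = attr f + attr g := by
  unfold attr
  rw [← lintegral_add_left (by fun_prop)]
  simp [add_mul]

lemma tfEnergy_congr (γ Z : ℝ) {f g : Space → ℝ≥0∞} (h : f =ᵐ[volume] g) :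
    tfEnergy γ Z f = tfEnergy γ Z g := by
  unfold tfEnergy
  rw [kin_congr h, attr_congr h, inter_congr h h]

/-! ### Positive definiteness of the Coulomb kernel -/

/-- A bilinear form whose kernel is a superposition of products. -/
lemma lintegral_superposition {X P : Type*} [MeasurableSpace X] [MeasurableSpace P]
    (μ : Measure X) [SFinite μ] (ν : Measure P) [SFinite ν] {Φ : P → X → ℝ≥0∞}
    (hΦ : Measurable (Function.uncurry Φ)) {f g : X → ℝ≥0∞} (hf : Measurable f)
    (hg : Measurable g) :
    ∫⁻ x, ∫⁻ y, f x * g y * ∫⁻ p, Φ p x * Φ p y ∂ν ∂μ ∂μ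
      = ∫⁻ p, (∫⁻ x, f x * Φ p x ∂μ) * (∫⁻ y, g y * Φ p y ∂μ) ∂ν := by
  have h1 : ∀ p, Measurable (Φ p) := fun p => hΦ.comp measurable_prodMk_left
  have h2 : ∀ x, Measurable fun p => Φ p x := fun x => hΦ.comp measurable_prodMk_right
  have h3 : Measurable fun q : X × P => Φ q.2 q.1 := hΦ.comp measurable_swap
  have hG : Measurable fun p => ∫⁻ y, g y * Φ p y ∂μ :=
    Measurable.lintegral_prod_right' (f := fun q : P × X => g q.2 * Φ q.1 q.2)
      ((hg.comp measurable_snd).mul hΦ)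
  calc ∫⁻ x, ∫⁻ y, f x * g y * ∫⁻ p, Φ p x * Φ p y ∂ν ∂μ ∂μ
      = ∫⁻ x, ∫⁻ y, ∫⁻ p, f x * Φ p x * (g y * Φ p y) ∂ν ∂μ ∂μ := by
        refine lintegral_congr fun x => lintegral_congr fun y => ?_
        rw [← lintegral_const_mul _ ((h2 x).fun_mul (h2 y))]
        exact lintegral_congr fun p => by ring
    _ = ∫⁻ x, ∫⁻ p, ∫⁻ y, f x * Φ p x * (g y * Φ p y) ∂μ ∂ν ∂μ := by
        refine lintegral_congr fun x => lintegral_lintegral_swap ?_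
        refine Measurable.aemeasurable ?_
        have := h2 x
        refine Measurable.mul ?_ ((hg.comp measurable_fst).mul h3)
        exact measurable_const.fun_mul (this.comp measurable_snd)
    _ = ∫⁻ x, ∫⁻ p, f x * Φ p x * ∫⁻ y, g y * Φ p y ∂μ ∂ν ∂μ := by
        refine lintegral_congr fun x => lintegral_congr fun p => ?_
        rw [lintegral_const_mul _ (hg.fun_mul (h1 p))]
    _ = ∫⁻ p, ∫⁻ x, f x * Φ p x * ∫⁻ y, g y * Φ p y ∂μ ∂μ ∂ν := by
        refine lintegral_lintegral_swap (Measurable.aemeasurable ?_)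
        exact ((hf.comp measurable_fst).mul h3).fun_mul (hG.comp measurable_snd)
    _ = _ := by
        refine lintegral_congr fun p => ?_
        rw [lintegral_mul_const _ (hf.fun_mul (h1 p))]

/-- The weight in the Gaussian decomposition of the Coulomb kernel. -/
noncomputable def gaussWeight (t : ℝ) : ℝ≥0∞ :=
  ENNReal.ofReal (t ^ (1 / 2 - 1 : ℝ) / Real.Gamma (1 / 2) / (Real.pi / (4 * t)) ^ (3 / 2 : ℝ))

/-- The Gaussian centred at `p.2` with exponent `2 * p.1`. -/
noncomputable def gaussBump (p : ℝ × Space) (x : Space) : ℝ≥0∞ :=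
  ENNReal.ofReal (Real.exp (-(2 * p.1) * ‖x - p.2‖ ^ 2))

lemma measurable_gaussWeight : Measurable gaussWeight := by
  unfold gaussWeight; fun_prop

lemma measurable_gaussBump : Measurable (Function.uncurry gaussBump) := by
  unfold gaussBump Function.uncurry; fun_prop

/-- By the parallelogram law, the product of the two Gaussians is a Gaussian in x - y times a
Gaussian in z centred at the midpoint of x and y; only the latter is integrated. -/
lemma lintegral_gaussBump_mul {t : ℝ} (ht : 0 < t) (x y : Space) :
    ∫⁻ z, gaussBump (t, z) x * gaussBump (t, z) y
      = ENNReal.ofReal (Real.exp (-(t * ‖x - y‖ ^ 2)) * (Real.pi / (4 * t)) ^ (3 / 2 : ℝ)) := by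
  have key : ∀ z : Space, gaussBump (t, z) x * gaussBump (t, z) y
      = ENNReal.ofReal (Real.exp (-(t * ‖x - y‖ ^ 2)) *
        Real.exp (-(4 * t) * ‖z - (2⁻¹ : ℝ) • (x + y)‖ ^ 2)) := by
    intro z
    unfold gaussBump
    rw [← ENNReal.ofReal_mul (Real.exp_nonneg _), ← Real.exp_add, ← Real.exp_add]
    congr 2
    have h := parallelogram_law_with_norm ℝ (x - z) (y - z)
    have e1 : (x - z) + (y - z) = (-2 : ℝ) • (z - (2⁻¹ : ℝ) • (x + y)) := by
      module
    have e2 : (x - z) - (y - z) = x - y := by abel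
    rw [e1, e2, norm_smul, show ‖(-2 : ℝ)‖ = 2 by norm_num] at h
    linear_combination t * h
  simp_rw [key]
  have hi : Integrable fun z : Space => Real.exp (-(4 * t) * ‖z‖ ^ 2) := by
    have := GaussianFourier.integral_rexp_neg_mul_sq_norm (V := Space) (b := 4 * t) (by positivity)
    -- A Bochner integral with a nonzero value can only come from an integrable function.
    refine not_imp_comm.1 integral_undef ?_
    rw [this]
    positivity
  have h0 := GaussianFourier.integral_rexp_neg_mul_sq_norm (V := Space) (b := 4 * t)
    (by positivity)
  rw [← ofReal_integral_eq_lintegral_ofReal ((hi.comp_sub_right _).const_mul _)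
    (Filter.Eventually.of_forall fun z => by positivity), integral_const_mul,
    integral_sub_right_eq_self (fun z : Space => Real.exp (-(4 * t) * ‖z‖ ^ 2)), h0]
  simp

/-- This is the Gamma integral 1/r = Γ(1/2)⁻¹ ∫ t^(-1/2) exp(-r² t) dt; `gaussWeight` divides out
the normalization left by the integration over the centres. -/
lemma kern_eq_gauss {x y : Space} (h : x ≠ y) :
    kern (x - y) = ∫⁻ p, gaussBump p x * gaussBump p y
      ∂(((volume.restrict (Set.Ioi (0:ℝ))).withDensity gaussWeight).prod volume) := by
  have hr : 0 < ‖x - y‖ := norm_pos_iff.2 (sub_ne_zero.2 h)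
  have hm : Measurable fun p => gaussBump p x * gaussBump p y :=
    (measurable_gaussBump.comp measurable_prodMk_right).mul
      (measurable_gaussBump.comp measurable_prodMk_right)
  have hG : 0 < Real.Gamma (1 / 2) := Real.Gamma_pos_of_pos (by norm_num)
  rw [lintegral_prod _ hm.aemeasurable,
    lintegral_withDensity_eq_lintegral_mul _ measurable_gaussWeight
      (hm.lintegral_prod_right' (f := fun p => gaussBump p x * gaussBump p y))]
  have e : ∀ t ∈ Set.Ioi (0:ℝ), (gaussWeight * fun t => ∫⁻ z, gaussBump (t, z) x *
      gaussBump (t, z) y) t = ENNReal.ofReal ((Real.Gamma (1 / 2))⁻¹ *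
        (t ^ (1 / 2 - 1 : ℝ) * Real.exp (-(‖x - y‖ ^ 2 * t)))) := by
    intro t ht
    have ht : 0 < t := ht
    simp only [Pi.mul_apply]
    rw [lintegral_gaussBump_mul ht, gaussWeight, ← ENNReal.ofReal_mul (by positivity)]
    congr 1
    have : (Real.pi / (4 * t)) ^ (3 / 2 : ℝ) ≠ 0 := by positivity
    rw [mul_comm t]
    field_simp
  rw [setLIntegral_congr_fun measurableSet_Ioi e]
  have h0 := Real.integral_rpow_mul_exp_neg_mul_Ioi (a := 1 / 2) (r := ‖x - y‖ ^ 2)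
    (by norm_num) (by positivity)
  have hv : (1 / ‖x - y‖ ^ 2) ^ (1 / 2 : ℝ) = ‖x - y‖⁻¹ := by
    rw [← Real.sqrt_eq_rpow, one_div, Real.sqrt_inv, Real.sqrt_sq hr.le]
  rw [hv] at h0
  have hi : IntegrableOn (fun t : ℝ => t ^ (1 / 2 - 1 : ℝ) * Real.exp (-(‖x - y‖ ^ 2 * t)))
      (Set.Ioi 0) := by
    refine not_imp_comm.1 integral_undef ?_
    rw [h0]; positivity
  rw [← ofReal_integral_eq_lintegral_ofReal (hi.const_mul _), integral_const_mul, h0]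
  · unfold kern
    rw [← mul_assoc, mul_comm _ (‖x - y‖⁻¹), mul_assoc, inv_mul_cancel₀ hG.ne', mul_one,
      ENNReal.ofReal_inv_of_pos hr, ofReal_norm]
  · filter_upwards [ae_restrict_mem measurableSet_Ioi] with t ht
    have ht : 0 < t := ht
    positivity

lemma inter_eq_gauss {f g : Space → ℝ≥0∞} (hf : Measurable f) (hg : Measurable g) :
    inter f g = ∫⁻ p, (∫⁻ x, f x * gaussBump p x) * (∫⁻ y, g y * gaussBump p y)
      ∂(((volume.restrict (Set.Ioi (0:ℝ))).withDensity gaussWeight).prod volume) := by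
  rw [← lintegral_superposition volume _ measurable_gaussBump hf hg, inter_eq hg]
  refine lintegral_congr fun x => lintegral_congr_ae ?_
  have : ∀ᵐ y : Space, y ≠ x := by simp [ae_iff]
  filter_upwards [this] with y hy
  rw [kern_eq_gauss hy.symm]

/-- Positive definiteness of the Coulomb interaction, for nonnegative distributions. -/
lemma two_mul_inter_le {f g : Space → ℝ≥0∞} (hf : Measurable f) (hg : Measurable g) :
    2 * inter f g ≤ inter f f + inter g g := by
  have hF : ∀ {f : Space → ℝ≥0∞}, Measurable f →
      Measurable fun p => ∫⁻ x, f x * gaussBump p x := fun {f} hf =>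
    Measurable.lintegral_prod_right' (f := fun q : (ℝ × Space) × Space => f q.2 * gaussBump q.1 q.2)
      ((hf.comp measurable_snd).mul measurable_gaussBump)
  rw [inter_eq_gauss hf hg, inter_eq_gauss hf hf, inter_eq_gauss hg hg,
    ← lintegral_add_left ((hF hf).fun_mul (hF hf)),
    ← lintegral_const_mul _ ((hF hf).fun_mul (hF hg))]
  -- All three interactions are now integrals over the same p, and the claim is 2ab ≤ a² + b² under
  -- the integral sign.
  refine lintegral_mono fun p => ?_
  generalize (∫⁻ x, f x * gaussBump p x) = a
  generalize (∫⁻ x, g x * gaussBump p x) = b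
  rcases eq_or_ne a ∞ with ha | ha
  · simp [ha]
  rcases eq_or_ne b ∞ with hb | hb
  · simp [hb]
  lift a to NNReal using ha
  lift b to NNReal using hb
  have h : 2 * (a * b) ≤ a * a + b * b := calc
    2 * (a * b) = 2 * a * b := by ring
    _ ≤ a ^ 2 + b ^ 2 := two_mul_le_add_sq a b
    _ = a * a + b * b := by ring
  simpa only [ENNReal.coe_add, ENNReal.coe_mul, ENNReal.coe_ofNat] using ENNReal.coe_le_coe.2 h

/-- Midpoint convexity: the square is expanded and the cross term absorbed by positive definiteness.
-/
lemma inter_avg_le {f g : Space → ℝ≥0∞} (hf : Measurable f) (hg : Measurable g) :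
    inter (fun x => 2⁻¹ * (f x + g x)) (fun x => 2⁻¹ * (f x + g x))
      ≤ 2⁻¹ * (inter f f + inter g g) := by
  have hfg : Measurable (f + g) := hf.add hg
  have h := inter_const_mul_left hfg (hfg.const_mul 2⁻¹) 2⁻¹
  have h2 := inter_const_mul_right hfg hfg 2⁻¹
  change inter (fun x => 2⁻¹ * (f + g) x) (fun x => 2⁻¹ * (f + g) x) ≤ _
  rw [h, h2, inter_add_add hf hg]
  have h4 : inter f f + 2 * inter f g + inter g g ≤ 2 * (inter f f + inter g g) := by
    calc _ ≤ inter f f + (inter f f + inter g g) + inter g g := by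
          gcongr; exact two_mul_inter_le hf hg
      _ = _ := by ring
  calc _ ≤ 2⁻¹ * (2⁻¹ * (2 * (inter f f + inter g g))) := by gcongr
    _ = _ := by
      rw [← mul_assoc 2⁻¹ 2, ENNReal.inv_mul_cancel (by norm_num) (by norm_num), one_mul]

/-! ### Bounds on the attraction and on potentials of charged balls -/

/-- Finite kinetic and Coulomb energy. -/
structure Admissible (f : Space → ℝ≥0∞) : Prop where
  measurable : Measurable f
  kin_ne_top : kin f ≠ ∞
  inter_ne_top : inter f f ≠ ∞

/-- Young's inequality after rescaling by η = δ^(3/5). It lets the attraction near the nucleus be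
absorbed into an arbitrarily small fraction of the kinetic energy. -/
lemma young_eps {δ : ℝ≥0∞} (h0 : δ ≠ 0) (ht : δ ≠ ∞) : ∃ C : ℝ≥0∞, C ≠ ∞ ∧
    ∀ a b : ℝ≥0∞, a * b ≤ δ * a ^ (5 / 3 : ℝ) + C * b ^ (5 / 2 : ℝ) := by
  set η : ℝ≥0∞ := δ ^ (3 / 5 : ℝ) with hη
  have hη0 : η ≠ 0 := by simp [hη, h0, ht]
  have hηt : η ≠ ∞ := ENNReal.rpow_ne_top_of_nonneg (by norm_num) ht
  have hηδ : η ^ (5 / 3 : ℝ) = δ := by rw [hη, ← ENNReal.rpow_mul]; norm_num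
  refine ⟨(η⁻¹) ^ (5 / 2 : ℝ), ENNReal.rpow_ne_top_of_nonneg (by norm_num) (by simp [hη0]), ?_⟩
  intro a b
  have hpq : (5 / 3 : ℝ).HolderConjugate (5 / 2) := by
    rw [Real.holderConjugate_iff]; norm_num
  have h := ENNReal.young_inequality (η * a) (η⁻¹ * b) hpq
  have e : η * a * (η⁻¹ * b) = a * b := by
    calc _ = (η * η⁻¹) * (a * b) := by ring
      _ = _ := by rw [ENNReal.mul_inv_cancel hη0 hηt, one_mul]
  rw [e, ENNReal.mul_rpow_of_nonneg _ _ (by norm_num), ENNReal.mul_rpow_of_nonneg _ _ (by norm_num),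
    hηδ] at h
  refine h.trans (add_le_add ?_ ?_)
  · exact ENNReal.div_le_of_le_mul (le_mul_of_one_le_right' (by norm_num))
  · exact ENNReal.div_le_of_le_mul (le_mul_of_one_le_right' (by norm_num))

/-- The exponent 5/2 is conjugate to 5/3; in polar coordinates the integrand is r² r^(-5/2) =
r^(-1/2), integrable at 0. -/
lemma setLIntegral_ball_kern_rpow (R : ℝ) :
    ∫⁻ x in Metric.ball (0 : Space) R, kern x ^ (5 / 2 : ℝ) ≠ ∞ := by
  have h : IntegrableOn (fun x : Space => ‖x‖ ^ (-(5 / 2) : ℝ)) (Metric.ball 0 R) := by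
    rw [integrableOn_fun_norm_addHaar (volume : Measure Space) (f := fun r => r ^ (-(5 / 2) : ℝ))]
    have : IntegrableOn (fun r : ℝ => r ^ (-(1/2) : ℝ)) (Set.Ioo 0 R) := by
      by_cases hR : 0 < R
      · exact (intervalIntegral.integrableOn_Ioo_rpow_iff hR).2 (by norm_num)
      · simp [Set.Ioo_eq_empty hR]
    refine this.congr_fun (fun r hr => ?_) measurableSet_Ioo
    simp only [finrank_euclideanSpace, Fintype.card_fin, smul_eq_mul]
    rw [← Real.rpow_natCast, ← Real.rpow_add hr.1]
    norm_num
  have h2 := h.lintegral_lt_top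
  refine (lt_of_le_of_lt (lintegral_mono_ae ?_) h2).ne
  have : ∀ᵐ y : Space, y ≠ 0 := by simp [ae_iff]
  filter_upwards [ae_restrict_of_ae this] with x hx
  have hx : 0 < ‖x‖ := norm_pos_iff.2 hx
  rw [kern, ← ofReal_norm, ← ENNReal.ofReal_inv_of_pos hx,
    ENNReal.ofReal_rpow_of_nonneg (by positivity) (by norm_num), Real.rpow_neg hx.le,
    Real.inv_rpow hx.le]

lemma kern_le_of_le_norm {r : ℝ} {x : Space} (h : r ≤ ‖x‖) : kern x ≤ (ENNReal.ofReal r)⁻¹ := by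
  rw [kern, ← ofReal_norm]
  exact ENNReal.inv_le_inv.2 (ENNReal.ofReal_le_ofReal h)

lemma le_kern_of_norm_le {r : ℝ} {x : Space} (h : ‖x‖ ≤ r) : (ENNReal.ofReal r)⁻¹ ≤ kern x := by
  rw [kern, ← ofReal_norm]
  exact ENNReal.inv_le_inv.2 (ENNReal.ofReal_le_ofReal h)

/-- The Coulomb potential at the centre of a uniformly charged ball. -/
noncomputable def ballPot (R : ℝ) : ℝ≥0∞ := ∫⁻ x in Metric.ball (0 : Space) R, kern x

lemma ballPot_ne_top (R : ℝ) : ballPot R ≠ ∞ := by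
  have h : ∀ x : Space, kern x ≤ 1 + kern x ^ (5 / 2 : ℝ) := by
    intro x
    rcases le_total (kern x) 1 with h | h
    · exact h.trans le_self_add
    · refine le_trans ?_ le_add_self
      calc kern x = kern x ^ (1 : ℝ) := by simp
        _ ≤ _ := ENNReal.rpow_le_rpow_of_exponent_le h (by norm_num)
  refine ne_top_of_le_ne_top ?_ (lintegral_mono h)
  rw [lintegral_add_left measurable_const]
  simp only [lintegral_const, one_mul, Measure.restrict_apply_univ]
  exact ENNReal.add_ne_top.2 ⟨measure_ball_lt_top.ne, setLIntegral_ball_kern_rpow R⟩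

/-- The potential of a uniformly charged ball is largest at its centre. -/
lemma setLIntegral_ball_kern_le (x : Space) (R : ℝ) :
    ∫⁻ y in Metric.ball (0 : Space) R, kern (x - y) ≤ ballPot R := by
  set A := Metric.ball (0 : Space) R
  set B := Metric.ball x R
  have hA : MeasurableSet A := measurableSet_ball
  have hB : MeasurableSet B := measurableSet_ball
  have e : ∫⁻ y in A, kern (x - y) = ∫⁻ y in B, kern y := by
    have hp := Measure.measurePreserving_sub_left (volume : Measure Space) x
    rw [← hp.setLIntegral_comp_preimage hB measurable_kern]
    congr 2
    ext y
    simp [A, B]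
  -- The balls A and B have equal volume, hence so do their differences. The kernel is at most 1/R
  -- off A and at least 1/R on A, so trading B \ A for A \ B increases the integral.
  have hvol : volume (B \ A) = volume (A \ B) := by
    have h1 := measure_inter_add_sdiff (μ := volume) A hB
    have h2 := measure_inter_add_sdiff (μ := volume) B hA
    have h3 : volume A = volume B := by
      simp only [A, B]; rw [Measure.addHaar_ball_center _ x]
    rw [h3, ← h2, Set.inter_comm] at h1
    exact ((ENNReal.add_right_inj
      (ne_top_of_le_ne_top measure_ball_lt_top.ne (measure_mono Set.inter_subset_left))).1 h1).symm
  rw [e, ← lintegral_inter_add_sdiff kern B hA]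
  unfold ballPot
  rw [← lintegral_inter_add_sdiff kern A hB, Set.inter_comm]
  gcongr 1
  calc ∫⁻ y in B \ A, kern y ≤ ∫⁻ y in B \ A, (ENNReal.ofReal R)⁻¹ :=
        setLIntegral_mono measurable_const fun y hy => kern_le_of_le_norm (by
          simpa [A] using hy.2)
    _ = ∫⁻ y in A \ B, (ENNReal.ofReal R)⁻¹ := by simp [hvol]
    _ ≤ _ := setLIntegral_mono measurable_kern fun y hy => le_kern_of_norm_le (by
          have : ‖y‖ < R := by simpa [A] using hy.1
          exact this.le)

/-- The quadratic growth in R obtained here beats the linear kinetic cost in `IsMinimizer.le_mass`.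
-/
lemma volume_ball_div_le_ballPot (R : ℝ) :
    volume (Metric.ball (0 : Space) R) * (ENNReal.ofReal R)⁻¹ ≤ ballPot R := by
  calc _ = ∫⁻ y in Metric.ball (0 : Space) R, (ENNReal.ofReal R)⁻¹ := by simp [mul_comm]
    _ ≤ _ := setLIntegral_mono measurable_kern fun y hy => le_kern_of_norm_le (by
          have : ‖y‖ < R := by simpa using hy
          exact this.le)

/-- With s fixed and R large, this shows that the potential per unit of volume tends to 0. -/
lemma ballPot_le (R s : ℝ) :
    ballPot R ≤ ballPot s + volume (Metric.ball (0 : Space) R) * (ENNReal.ofReal s)⁻¹ := by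
  unfold ballPot
  rw [← lintegral_inter_add_sdiff kern _ (measurableSet_ball (x := (0 : Space)) (ε := s))]
  gcongr
  · exact Set.inter_subset_right
  calc _ ≤ ∫⁻ y in Metric.ball (0 : Space) R \ Metric.ball 0 s, (ENNReal.ofReal s)⁻¹ :=
        setLIntegral_mono measurable_const fun y hy => kern_le_of_le_norm (by
          simpa using hy.2)
    _ ≤ ∫⁻ y in Metric.ball (0 : Space) R, (ENNReal.ofReal s)⁻¹ :=
        lintegral_mono_set Set.sdiff_subset
    _ = _ := by simp [mul_comm]

lemma volume_ball_eq {R : ℝ} (hR : 0 ≤ R) : volume (Metric.ball (0 : Space) R)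
    = ENNReal.ofReal (R ^ 3) * volume (Metric.ball (0 : Space) 1) := by
  rw [Measure.addHaar_ball _ _ hR]; simp

/-- Near the origin, the attraction is controlled by the kinetic energy. -/
lemma setLIntegral_ball_attr_le {δ : ℝ≥0∞} (h0 : δ ≠ 0) (ht : δ ≠ ∞) (R : ℝ) :
    ∃ C : ℝ≥0∞, C ≠ ∞ ∧ ∀ f : Space → ℝ≥0∞, Measurable f →
      ∫⁻ x in Metric.ball (0 : Space) R, f x * kern x ≤ δ * kin f + C := by
  obtain ⟨C, hC, h⟩ := young_eps h0 ht
  refine ⟨C * ∫⁻ x in Metric.ball (0 : Space) R, kern x ^ (5 / 2 : ℝ),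
    ENNReal.mul_ne_top hC (setLIntegral_ball_kern_rpow R), fun f hf => ?_⟩
  calc _ ≤ ∫⁻ x in Metric.ball (0 : Space) R,
        (δ * f x ^ (5 / 3 : ℝ) + C * kern x ^ (5 / 2 : ℝ)) := lintegral_mono fun x => h _ _
    _ = δ * (∫⁻ x in Metric.ball (0 : Space) R, f x ^ (5 / 3 : ℝ)) +
        C * ∫⁻ x in Metric.ball (0 : Space) R, kern x ^ (5 / 2 : ℝ) := by
      rw [lintegral_add_left (by fun_prop), lintegral_const_mul _ (by fun_prop),
        lintegral_const_mul _ (by fun_prop)]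
    _ ≤ _ := by
      gcongr
      exact setLIntegral_le_lintegral _ _

lemma setLIntegral_compl_ball_attr_le {f : Space → ℝ≥0∞} (hf : Measurable f) (R : ℝ) :
    ∫⁻ x in (Metric.ball (0 : Space) R)ᶜ, f x * kern x
      ≤ (∫⁻ x in (Metric.ball (0 : Space) R)ᶜ, f x) * (ENNReal.ofReal R)⁻¹ := by
  calc _ ≤ ∫⁻ x in (Metric.ball (0 : Space) R)ᶜ, (ENNReal.ofReal R)⁻¹ * f x := by
        refine setLIntegral_mono' measurableSet_ball.compl fun x hx => ?_
        rw [mul_comm]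
        gcongr
        exact kern_le_of_le_norm (by simpa using hx)
    _ = _ := by rw [mul_comm, lintegral_const_mul _ hf]

lemma attr_eq_add (f : Space → ℝ≥0∞) (R : ℝ) :
    attr f = (∫⁻ x in Metric.ball (0 : Space) R, f x * kern x) +
      ∫⁻ x in (Metric.ball (0 : Space) R)ᶜ, f x * kern x :=
  (lintegral_add_compl _ measurableSet_ball).symm

lemma attr_le_of_mass {δ : ℝ≥0∞} (h0 : δ ≠ 0) (ht : δ ≠ ∞) :
    ∃ C : ℝ≥0∞, C ≠ ∞ ∧ ∀ f : Space → ℝ≥0∞, Measurable f →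
      attr f ≤ δ * kin f + C + ∫⁻ x, f x := by
  obtain ⟨C, hC, h⟩ := setLIntegral_ball_attr_le h0 ht 1
  refine ⟨C, hC, fun f hf => ?_⟩
  rw [attr_eq_add f 1]
  refine add_le_add (h f hf) ?_
  · refine (setLIntegral_compl_ball_attr_le hf 1).trans ?_
    simp only [ENNReal.ofReal_one, inv_one, mul_one]
    exact setLIntegral_le_lintegral _ _

/-- The mass may be infinite, so the tail needs the Coulomb energy: if f is not null, its potential
is finite at some z, and away from the origin 1/|x| is at most (1 + |z|)/|z - x|. -/
lemma attr_ne_top {f : Space → ℝ≥0∞} (hf : Admissible f) : attr f ≠ ∞ := by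
  obtain ⟨C, hC, h⟩ := setLIntegral_ball_attr_le (δ := 1) (by simp) (by simp) 1
  rw [attr_eq_add f 1]
  refine ENNReal.add_ne_top.2 ⟨ne_top_of_le_ne_top
    (ENNReal.add_ne_top.2 ⟨by simpa using hf.kin_ne_top, hC⟩) (h f hf.measurable), ?_⟩
  by_cases h0 : f =ᵐ[volume] 0
  · have : (∫⁻ x in (Metric.ball (0 : Space) 1)ᶜ, f x * kern x) = 0 := by
      refine (lintegral_congr_ae ((ae_restrict_of_ae h0).mono fun x hx => ?_)).trans
        lintegral_zero
      simp [hx]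
    simp [this]
  have hlt := ae_lt_top (hf.measurable.mul (measurable_potential hf.measurable)) hf.inter_ne_top
  obtain ⟨z, hz1, hz2⟩ : ∃ z, f z ≠ 0 ∧ f z * potential f z < ∞ := by
    by_contra! hcon
    refine h0 (hlt.mono fun x hx => ?_)
    by_contra hne
    exact absurd hx (not_lt.2 (hcon x hne))
  have hpot : potential f z ≠ ∞ := fun h => by
    rw [h, ENNReal.mul_top hz1] at hz2; exact lt_irrefl _ hz2
  have hc : ENNReal.ofReal (1 + ‖z‖) ≠ ∞ := ENNReal.ofReal_ne_top
  refine ne_top_of_le_ne_top (ENNReal.mul_ne_top hc hpot) ?_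
  unfold potential
  rw [← lintegral_const_mul _ (hf.measurable.fun_mul (by fun_prop))]
  refine (setLIntegral_mono' measurableSet_ball.compl fun x hx => ?_).trans
    (setLIntegral_le_lintegral _ _)
  have hx : 1 ≤ ‖x‖ := by simpa using hx
  rw [mul_left_comm]
  gcongr
  have hn : ‖z - x‖ ≤ (1 + ‖z‖) * ‖x‖ := by
    nlinarith [norm_sub_le z x, norm_nonneg z]
  have h3 := le_kern_of_norm_le hn
  have hpos : 0 < 1 + ‖z‖ := by positivity
  rw [ENNReal.ofReal_mul hpos.le, ENNReal.mul_inv (by simp) (by simp)] at h3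
  calc kern x = ENNReal.ofReal (1 + ‖z‖) * ((ENNReal.ofReal (1 + ‖z‖))⁻¹ *
        (ENNReal.ofReal ‖x‖)⁻¹) := by
        rw [← mul_assoc, ENNReal.mul_inv_cancel (by simp [hpos]) hc, one_mul, kern, ofReal_norm]
    _ ≤ _ := by gcongr

/-! ### Newton's theorem -/

lemma lintegral_space_eq {F : Space → ℝ≥0∞} (hF : Measurable F) :
    ∫⁻ y, F y = ∫⁻ t : ℝ, ∫⁻ p : ℝ × ℝ, F (WithLp.toLp 2 ![t, p.1, p.2]) := by
  have h1 := (PiLp.volume_preserving_toLp (Fin 3)).lintegral_comp hF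
  rw [← h1]
  have h2 := ((volume_preserving_piFinSuccAbove (fun _ : Fin 3 => ℝ) 0).symm).lintegral_comp
    (hF.comp (PiLp.volume_preserving_toLp (Fin 3)).measurable)
  simp only [Function.comp_def] at h2
  rw [← h2]
  have hm : Measurable fun a : ℝ × (Fin 2 → ℝ) => F (WithLp.toLp 2
      ((MeasurableEquiv.piFinSuccAbove (fun _ : Fin 3 => ℝ) 0).symm a)) :=
    (hF.comp (PiLp.volume_preserving_toLp (Fin 3)).measurable).comp
      (MeasurableEquiv.piFinSuccAbove (fun _ : Fin 3 => ℝ) 0).symm.measurable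
  rw [Measure.volume_eq_prod]
  refine (lintegral_prod _ hm.aemeasurable).trans (lintegral_congr fun t => ?_)
  have h3 := ((volume_preserving_finTwoArrow ℝ).symm).lintegral_comp
    (hm.comp (measurable_prodMk_left (x := t)))
  refine h3.symm.trans (lintegral_congr fun p => ?_)
  simp only [Function.comp_def]
  congr 2
  funext i
  fin_cases i <;> rfl

lemma lintegral_plane_radial {h : ℝ → ℝ≥0∞} (hh : Measurable h) (t : ℝ) :
    ∫⁻ p : ℝ × ℝ, h (√(t ^ 2 + (p.1 ^ 2 + p.2 ^ 2)))
      = ∫⁻ s in Set.Ioi |t|, ENNReal.ofReal (2 * Real.pi * s) * h s := by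
  rw [← lintegral_comp_polarCoord_symm]
  have e : ∀ p : ℝ × ℝ, (polarCoord.symm p).1 ^ 2 + (polarCoord.symm p).2 ^ 2 = p.1 ^ 2 := by
    intro p
    simp only [polarCoord_symm_apply]
    nlinarith [Real.sin_sq_add_cos_sq p.2]
  simp_rw [e, smul_eq_mul]
  have hm : Measurable fun r : ℝ => ENNReal.ofReal r * h (√(t ^ 2 + r ^ 2)) := by fun_prop
  rw [polarCoord_target, Measure.volume_eq_prod, ← Measure.prod_restrict,
    lintegral_prod (fun p : ℝ × ℝ => ENNReal.ofReal p.1 * h (√(t ^ 2 + p.1 ^ 2)))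
      (hm.comp measurable_fst).aemeasurable]
  simp only [lintegral_const, Measure.restrict_apply_univ, Real.volume_Ioo]
  rw [lintegral_mul_const _ hm]
  -- Substitution s = √(t² + r²), for which s ds = r dr.
  have himg : (fun r : ℝ => √(t ^ 2 + r ^ 2)) '' Set.Ioi 0 = Set.Ioi |t| := by
    ext s
    simp only [Set.mem_image, Set.mem_Ioi]
    constructor
    · rintro ⟨r, hr, rfl⟩
      rw [← Real.sqrt_sq_eq_abs]
      exact Real.sqrt_lt_sqrt (sq_nonneg _) (by nlinarith)
    · intro hs
      have hs0 : 0 < s := (abs_nonneg t).trans_lt hs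
      have hlt : t ^ 2 < s ^ 2 := by
        rw [← sq_abs t]; exact pow_lt_pow_left₀ hs (abs_nonneg _) (by norm_num)
      refine ⟨√(s ^ 2 - t ^ 2), Real.sqrt_pos.2 (by linarith), ?_⟩
      rw [Real.sq_sqrt (by linarith)]
      rw [show t ^ 2 + (s ^ 2 - t ^ 2) = s ^ 2 by ring, Real.sqrt_sq hs0.le]
  have hd : ∀ r ∈ Set.Ioi (0:ℝ), HasDerivWithinAt (fun r : ℝ => √(t ^ 2 + r ^ 2))
      (r / √(t ^ 2 + r ^ 2)) (Set.Ioi 0) r := by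
    intro r hr
    have hr : 0 < r := hr
    have h1 : HasDerivAt (fun r : ℝ => t ^ 2 + r ^ 2) (2 * r) r := by
      simpa using (hasDerivAt_pow 2 r).const_add (t ^ 2)
    refine (h1.sqrt (by positivity)).hasDerivWithinAt.congr_deriv ?_
    field_simp
  have hinj : Set.InjOn (fun r : ℝ => √(t ^ 2 + r ^ 2)) (Set.Ioi 0) := by
    intro a ha b hb hab
    have ha : 0 < a := ha
    have hb : 0 < b := hb
    simp only at hab
    rw [Real.sqrt_inj (by positivity) (by positivity)] at hab
    exact (pow_left_inj₀ ha.le hb.le two_ne_zero).1 (by linarith)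
  rw [← himg, lintegral_image_eq_lintegral_abs_deriv_mul measurableSet_Ioi hd hinj,
    ← lintegral_mul_const _ hm]
  refine setLIntegral_congr_fun measurableSet_Ioi fun r hr => ?_
  have hr : 0 < r := hr
  rw [← mul_assoc, ← ENNReal.ofReal_mul (abs_nonneg _), mul_right_comm,
    ← ENNReal.ofReal_mul hr.le]
  congr 2
  have : 0 < √(t ^ 2 + r ^ 2) := Real.sqrt_pos.2 (by positivity)
  rw [abs_of_pos (by positivity)]
  field_simp
  ring

/-- Integration of a function of `|y|` and one coordinate of `y` (Archimedes' hat-box theorem). -/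
lemma lintegral_norm_coord {G : ℝ → ℝ → ℝ≥0∞} (hG : Measurable (Function.uncurry G)) :
    ∫⁻ y : Space, G ‖y‖ (y 0)
      = ∫⁻ s in Set.Ioi (0 : ℝ), ENNReal.ofReal (2 * Real.pi * s) * ∫⁻ t in Set.Ioo (-s) s, G s t := by
  have hGm : ∀ s, Measurable (G s) := fun s => hG.comp measurable_prodMk_left
  have hGm' : ∀ t, Measurable fun s => G s t := fun t => hG.comp measurable_prodMk_right
  have hF : Measurable fun y : Space => G ‖y‖ (y 0) :=
    hG.comp (measurable_norm.prodMk (by fun_prop))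
  rw [lintegral_space_eq hF]
  have e : ∀ (t : ℝ) (p : ℝ × ℝ), ‖(WithLp.toLp 2 ![t, p.1, p.2] : Space)‖
      = √(t ^ 2 + (p.1 ^ 2 + p.2 ^ 2)) := by
    intro t p
    rw [EuclideanSpace.norm_eq]
    simp [Fin.sum_univ_three, add_assoc]
  simp_rw [e]
  have hind : ∀ t, ∫⁻ p : ℝ × ℝ, G (√(t ^ 2 + (p.1 ^ 2 + p.2 ^ 2))) t
      = ∫⁻ s, {q : ℝ × ℝ | |q.1| < q.2}.indicator
        (fun q => ENNReal.ofReal (2 * Real.pi * q.2) * G q.2 q.1) (t, s) := by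
    intro t
    rw [lintegral_plane_radial (hGm' t), ← lintegral_indicator measurableSet_Ioi]
    rfl
  refine (lintegral_congr hind).trans ?_
  have hS : MeasurableSet {q : ℝ × ℝ | |q.1| < q.2} :=
    measurableSet_lt (by fun_prop) measurable_snd
  have hM : Measurable ({q : ℝ × ℝ | |q.1| < q.2}.indicator
        (fun q => ENNReal.ofReal (2 * Real.pi * q.2) * G q.2 q.1)) :=
    Measurable.indicator ((by fun_prop : Measurable fun q : ℝ × ℝ =>
      ENNReal.ofReal (2 * Real.pi * q.2)).mul (hG.comp measurable_swap)) hS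
  refine (lintegral_lintegral_swap (f := Function.curry ({q : ℝ × ℝ | |q.1| < q.2}.indicator
    (fun q => ENNReal.ofReal (2 * Real.pi * q.2) * G q.2 q.1))) hM.aemeasurable).trans ?_
  rw [← lintegral_indicator measurableSet_Ioi]
  refine lintegral_congr fun s => ?_
  by_cases hs : 0 < s
  · rw [Set.indicator_of_mem (show s ∈ Set.Ioi (0:ℝ) from hs), ← lintegral_const_mul _ (hGm s),
      ← lintegral_indicator measurableSet_Ioo]
    refine lintegral_congr fun t => ?_
    simp only [Function.curry, Set.indicator, Set.mem_ofPred_eq, Set.mem_Ioo, abs_lt]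
  · rw [Set.indicator_of_notMem (show s ∉ Set.Ioi (0:ℝ) from hs)]
    rw [lintegral_congr (g := 0), lintegral_zero_fun]
    intro t
    refine Set.indicator_of_notMem (fun h => hs ?_) _
    exact (abs_nonneg t).trans_lt h

/-- The core of Newton's theorem: the mean of 1/|x - y| over the sphere |y| = s < R = |x| is 1/R.
The radicand is |x - y|² when x lies on the first axis and y has first coordinate t; at t = ±s the
root is R ∓ s because s < R. -/
lemma setLIntegral_inv_dist {R s : ℝ} (hs : 0 < s) (hR : s < R) :
    ∫⁻ t in Set.Ioo (-s) s, (ENNReal.ofReal (√(R ^ 2 - 2 * R * t + s ^ 2)))⁻¹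
      = ∫⁻ _t in Set.Ioo (-s) s, (ENNReal.ofReal R)⁻¹ := by
  have hR0 : 0 < R := hs.trans hR
  have hpos : ∀ t ∈ Set.Icc (-s) s, 0 < R ^ 2 - 2 * R * t + s ^ 2 := by
    intro t ht
    nlinarith [mul_le_mul_of_nonneg_left ht.2 hR0.le, sq_pos_of_pos (sub_pos.2 hR)]
  have hcont : ContinuousOn (fun t => (√(R ^ 2 - 2 * R * t + s ^ 2))⁻¹) (Set.Icc (-s) s) :=
    ContinuousOn.inv₀ (by fun_prop) fun t ht => (Real.sqrt_pos.2 (hpos t ht)).ne'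
  have hii : IntervalIntegrable (fun t => (√(R ^ 2 - 2 * R * t + s ^ 2))⁻¹) volume (-s) s :=
    ContinuousOn.intervalIntegrable (by rwa [Set.uIcc_of_le (by linarith)])
  have hint : ∫ t in (-s)..s, (√(R ^ 2 - 2 * R * t + s ^ 2))⁻¹ = 2 * s / R := by
    rw [intervalIntegral.integral_eq_sub_of_hasDerivAt
      (f := fun t => -√(R ^ 2 - 2 * R * t + s ^ 2) / R) _ hii]
    · rw [show R ^ 2 - 2 * R * s + s ^ 2 = (R - s) ^ 2 by ring,
        show R ^ 2 - 2 * R * (-s) + s ^ 2 = (R + s) ^ 2 by ring,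
        Real.sqrt_sq (by linarith), Real.sqrt_sq (by linarith)]
      ring
    · intro t ht
      rw [Set.uIcc_of_le (by linarith)] at ht
      have h1 : HasDerivAt (fun t : ℝ => R ^ 2 - 2 * R * t + s ^ 2) (-(2 * R)) t := by
        have := (((hasDerivAt_id t).const_mul (2 * R)).const_sub (R ^ 2)).add_const (s ^ 2)
        simpa using this
      refine ((h1.sqrt (hpos t ht).ne').neg.div_const R).congr_deriv ?_
      have := Real.sqrt_pos.2 (hpos t ht)
      field_simp
  have h1 : ∫⁻ t in Set.Ioo (-s) s, (ENNReal.ofReal (√(R ^ 2 - 2 * R * t + s ^ 2)))⁻¹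
      = ∫⁻ t in Set.Ioo (-s) s, ENNReal.ofReal ((√(R ^ 2 - 2 * R * t + s ^ 2))⁻¹) :=
    setLIntegral_congr_fun measurableSet_Ioo fun t ht => by
      rw [ENNReal.ofReal_inv_of_pos (Real.sqrt_pos.2 (hpos t ⟨ht.1.le, ht.2.le⟩))]
  rw [h1, Measure.restrict_congr_set Ioo_ae_eq_Ioc, ← ofReal_integral_eq_lintegral_ofReal hii.1
    (Filter.Eventually.of_forall fun t => by positivity),
    ← intervalIntegral.integral_of_le (by linarith), hint]
  simp only [lintegral_const, Measure.restrict_apply_univ, Real.volume_Ioc]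
  rw [← ENNReal.ofReal_inv_of_pos hR0, ← ENNReal.ofReal_mul (by positivity)]
  congr 1
  field_simp
  ring

lemma exists_isometry_apply_eq {x y : Space} (h : ‖x‖ = ‖y‖) : ∃ L : Space ≃ₗᵢ[ℝ] Space, L x = y :=
  ⟨_, Submodule.reflection_sub h⟩

/-- **Newton's theorem**: outside its support, a radial charge distribution acts as a point
charge at the origin. -/
lemma potential_radial {k : ℝ → ℝ≥0∞} (hk : Measurable k) {x : Space}
    (hx : ∀ s, ‖x‖ ≤ s → k s = 0) :
    potential (fun y => k ‖y‖) x = kern x * ∫⁻ y : Space, k ‖y‖ := by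
  set R := ‖x‖ with hR
  -- By rotation invariance x may be moved to the first axis, where the distance to y depends only
  -- on |y| and the first coordinate of y.
  set x' : Space := EuclideanSpace.single 0 R with hx'
  have hn : ‖x‖ = ‖x'‖ := by simp [hx', hR]
  obtain ⟨L, hL⟩ := exists_isometry_apply_eq hn
  have e1 : potential (fun y => k ‖y‖) x = ∫⁻ y : Space, k ‖y‖ * kern (x' - y) := by
    have := L.measurePreserving.lintegral_comp
      (f := fun y : Space => k ‖y‖ * kern (x' - y)) (by fun_prop)
    rw [← this]
    refine lintegral_congr fun y => ?_
    rw [← hL, ← map_sub, L.norm_map]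
    simp only [kern, enorm_eq_nnnorm, L.nnnorm_map]
  have e2 : ∀ y : Space, kern (x' - y)
      = (ENNReal.ofReal (√(R ^ 2 - 2 * R * y 0 + ‖y‖ ^ 2)))⁻¹ := by
    intro y
    rw [kern, ← ofReal_norm]
    congr 2
    rw [← Real.sqrt_sq (norm_nonneg (x' - y)), norm_sub_sq_real, ← hn]
    congr 2
    simp [hx', EuclideanSpace.inner_single_left]
    ring
  rw [e1, ← lintegral_const_mul _ (by fun_prop)]
  simp_rw [e2]
  have hm : Measurable (Function.uncurry fun s t =>
      k s * (ENNReal.ofReal (√(R ^ 2 - 2 * R * t + s ^ 2)))⁻¹) := by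
    unfold Function.uncurry; fun_prop
  rw [lintegral_norm_coord (G := fun s t =>
      k s * (ENNReal.ofReal (√(R ^ 2 - 2 * R * t + s ^ 2)))⁻¹) hm,
    lintegral_norm_coord (G := fun s _ => kern x * k s) (by unfold Function.uncurry; fun_prop)]
  refine setLIntegral_congr_fun measurableSet_Ioi fun s hs => ?_
  congr 1
  by_cases hsR : R ≤ s
  · simp [hx s hsR]
  · rw [lintegral_const_mul _ (by fun_prop), setLIntegral_inv_dist hs (not_le.1 hsR),
      ← lintegral_const_mul _ (by fun_prop)]
    simp [kern, hR, mul_comm]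

/-! ### Passage between L^(5/3) classes and `ℝ≥0∞`-valued functions -/

instance fact_one_le_five_thirds : Fact ((1 : ℝ≥0∞) ≤ 5 / 3) :=
  ⟨by rw [ENNReal.le_div_iff_mul_le (by simp) (by simp)]; norm_num⟩

/-- The `ℝ≥0∞`-valued function underlying a density. -/
noncomputable def dens (ρ : Density) (x : Space) : ℝ≥0∞ := ENNReal.ofReal (ρ x)

lemma measurable_coe (ρ : Density) : Measurable ρ := (Lp.stronglyMeasurable ρ).measurable

lemma measurable_dens (ρ : Density) : Measurable (dens ρ) := (measurable_coe ρ).ennreal_ofReal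

lemma toReal_five_thirds : (5 / 3 : ℝ≥0∞).toReal = 5 / 3 := by simp

lemma lintegral_enorm_rpow (ρ : Density) :
    ∫⁻ x, ‖ρ x‖ₑ ^ (5 / 3 : ℝ) = ENNReal.ofReal (‖ρ‖ ^ (5 / 3 : ℝ)) := by
  have hp : (5 / 3 : ℝ≥0∞) ≠ 0 := by norm_num
  have hp' : (5 / 3 : ℝ≥0∞) ≠ ∞ := ENNReal.div_ne_top (by norm_num) (by norm_num)
  have h := eLpNorm_eq_lintegral_rpow_enorm_toReal (f := ρ) (μ := (volume : Measure Space)) hp hp'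
  rw [toReal_five_thirds] at h
  rw [← ENNReal.ofReal_rpow_of_nonneg (x := ‖ρ‖) ENNReal.toReal_nonneg (by norm_num), Lp.norm_def,
    ENNReal.ofReal_toReal (Lp.eLpNorm_ne_top ρ), h, ← ENNReal.rpow_mul]
  norm_num

lemma dens_ae_eq_enorm {ρ : Density} (h : ∀ᵐ x : Space, 0 ≤ ρ x) :
    dens ρ =ᵐ[volume] fun x => ‖ρ x‖ₑ := by
  filter_upwards [h] with x hx
  rw [dens, Real.enorm_of_nonneg hx]

lemma kin_dens {ρ : Density} (h : ∀ᵐ x : Space, 0 ≤ ρ x) :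
    kin (dens ρ) = ENNReal.ofReal (‖ρ‖ ^ (5 / 3 : ℝ)) := by
  rw [kin_congr (dens_ae_eq_enorm h), kin, lintegral_enorm_rpow]

lemma coulomb_eq {ρ : Density} (h : ∀ᵐ x : Space, 0 ≤ ρ x) :
    coulomb ρ = 2⁻¹ * inter (dens ρ) (dens ρ) := by
  rw [coulomb, inter_eq (measurable_dens ρ)]
  congr 1
  refine lintegral_congr_ae (h.mono fun x hx => lintegral_congr_ae ?_)
  -- On the diagonal the real quotient takes the value 0 while `kern` is ∞; the diagonal is
  -- discarded as a null set.
  have : ∀ᵐ y : Space, y ≠ x := by simp [ae_iff]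
  filter_upwards [this, h] with y hy hy0
  have hpos : 0 < ‖x - y‖ := norm_pos_iff.2 (sub_ne_zero.2 hy.symm)
  rw [ENNReal.ofReal_div_of_pos hpos, ENNReal.ofReal_mul hx, div_eq_mul_inv, ofReal_norm]
  rfl

lemma mem_admissible_iff {ρ : Density} :
    ρ ∈ admissible ↔ (∀ᵐ x : Space, 0 ≤ ρ x) ∧ Admissible (dens ρ) := by
  unfold admissible
  constructor
  · rintro ⟨h, h2⟩
    refine ⟨h, measurable_dens ρ, by rw [kin_dens h]; exact ENNReal.ofReal_ne_top, fun ht => ?_⟩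
    rw [coulomb_eq h, ht] at h2
    simp at h2
  · rintro ⟨h, h2⟩
    refine ⟨h, ?_⟩
    rw [coulomb_eq h]
    exact ENNReal.mul_lt_top (by simp) h2.inter_ne_top.lt_top

/-- The Bochner integral can be split only if both terms are integrable; for the attraction this is
`attr_ne_top`. -/
lemma energy_eq (γ Z : ℝ) {ρ : Density} (h : ρ ∈ admissible) :
    energy γ Z ρ = tfEnergy γ Z (dens ρ) := by
  obtain ⟨h0, ha⟩ := mem_admissible_iff.1 h
  have hk : ∀ᵐ x : Space, ENNReal.ofReal (ρ x ^ (5 / 3 : ℝ)) = dens ρ x ^ (5 / 3 : ℝ) := by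
    filter_upwards [h0] with x hx
    rw [dens, ENNReal.ofReal_rpow_of_nonneg hx (by norm_num)]
  have hne : ∀ᵐ x : Space, x ≠ 0 := by simp [ae_iff]
  have hat : ∀ᵐ x : Space, ENNReal.ofReal (‖x‖⁻¹ * ρ x) = dens ρ x * kern x := by
    filter_upwards [hne] with x hx
    have hpos : 0 < ‖x‖ := norm_pos_iff.2 hx
    rw [dens, kern, ENNReal.ofReal_mul (by positivity), ENNReal.ofReal_inv_of_pos hpos,
      ofReal_norm, mul_comm]
  have hm1 : Measurable fun x : Space => ρ x ^ (5 / 3 : ℝ) := (measurable_coe ρ).pow_const _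
  have hm2 : Measurable fun x : Space => ‖x‖⁻¹ * ρ x :=
    measurable_norm.inv.mul (measurable_coe ρ)
  have hn1 : 0 ≤ᵐ[volume] fun x : Space => ρ x ^ (5 / 3 : ℝ) :=
    h0.mono fun x hx => Real.rpow_nonneg hx _
  have hn2 : 0 ≤ᵐ[volume] fun x : Space => ‖x‖⁻¹ * ρ x :=
    h0.mono fun x hx => mul_nonneg (by positivity) hx
  have hi1 : Integrable fun x : Space => ρ x ^ (5 / 3 : ℝ) := by
    refine ⟨hm1.aestronglyMeasurable, ?_⟩
    rw [hasFiniteIntegral_iff_ofReal hn1, lintegral_congr_ae hk]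
    exact ha.kin_ne_top.lt_top
  have hi2 : Integrable fun x : Space => ‖x‖⁻¹ * ρ x := by
    refine ⟨hm2.aestronglyMeasurable, ?_⟩
    rw [hasFiniteIntegral_iff_ofReal hn2, lintegral_congr_ae hat]
    exact (attr_ne_top ha).lt_top
  have e : ∀ x : Space, 3 / 5 * γ * ρ x ^ (5 / 3 : ℝ) - Z / ‖x‖ * ρ x
      = 3 / 5 * γ * ρ x ^ (5 / 3 : ℝ) - Z * (‖x‖⁻¹ * ρ x) := fun x => by ring
  unfold energy tfEnergy
  simp_rw [e]
  rw [integral_sub (hi1.const_mul _) (hi2.const_mul _), integral_const_mul, integral_const_mul,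
    integral_eq_lintegral_of_nonneg_ae hn1 hi1.1, integral_eq_lintegral_of_nonneg_ae hn2 hi2.1,
    lintegral_congr_ae hk, lintegral_congr_ae hat, coulomb_eq h0]
  simp only [ENNReal.toReal_mul, ENNReal.toReal_inv, ENNReal.toReal_ofNat, kin, attr]
  ring

lemma exists_density {f : Space → ℝ≥0∞} (hf : Measurable f) (hk : kin f ≠ ∞) :
    ∃ ρ : Density, (∀ᵐ x : Space, 0 ≤ ρ x) ∧ dens ρ =ᵐ[volume] f := by
  have hfin : ∀ᵐ x : Space, f x ≠ ∞ := by
    filter_upwards [ae_lt_top (hf.pow_const _) hk] with x hx h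
    rw [h] at hx
    simp at hx
  have hp : (5 / 3 : ℝ≥0∞) ≠ 0 := by norm_num
  have hp' : (5 / 3 : ℝ≥0∞) ≠ ∞ := ENNReal.div_ne_top (by norm_num) (by norm_num)
  have hm : MemLp (fun x => (f x).toReal) (5 / 3 : ℝ≥0∞) (volume : Measure Space) := by
    refine ⟨hf.ennreal_toReal.aestronglyMeasurable, ?_⟩
    rw [eLpNorm_lt_top_iff_lintegral_rpow_enorm_lt_top hp hp', toReal_five_thirds]
    refine lt_of_eq_of_lt (lintegral_congr_ae ?_) hk.lt_top
    filter_upwards [hfin] with x hx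
    rw [Real.enorm_of_nonneg ENNReal.toReal_nonneg, ENNReal.ofReal_toReal hx]
  refine ⟨hm.toLp, ?_, ?_⟩
  · filter_upwards [hm.coeFn_toLp] with x hx
    rw [hx]; exact ENNReal.toReal_nonneg
  · filter_upwards [hm.coeFn_toLp, hfin] with x hx hx2
    rw [dens, hx, ENNReal.ofReal_toReal hx2]

lemma Admissible.congr {f g : Space → ℝ≥0∞} (hf : Admissible f) (hg : Measurable g)
    (h : f =ᵐ[volume] g) : Admissible g :=
  ⟨hg, by rw [← kin_congr h]; exact hf.kin_ne_top, by
    rw [← inter_congr h h]; exact hf.inter_ne_top⟩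

lemma exists_density_of_admissible (γ Z : ℝ) {f : Space → ℝ≥0∞} (hf : Admissible f) :
    ∃ ρ ∈ admissible, dens ρ =ᵐ[volume] f ∧ mass ρ = ∫⁻ x, f x ∧ energy γ Z ρ = tfEnergy γ Z f := by
  obtain ⟨ρ, h0, h⟩ := exists_density hf.measurable hf.kin_ne_top
  have hρ : ρ ∈ admissible := mem_admissible_iff.2 ⟨h0, hf.congr (measurable_dens ρ) h.symm⟩
  exact ⟨ρ, hρ, h, lintegral_congr_ae h, by rw [energy_eq γ Z hρ, tfEnergy_congr γ Z h]⟩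

/-! ### Uniform convexity and uniqueness -/

/-- Quantitative strict convexity of `t ↦ t ^ (5/3)`. -/
lemma exists_uniform_convexity {δ : ℝ} (hδ : 0 < δ) : ∃ C : ℝ, 0 ≤ C ∧ ∀ a b : ℝ, 0 ≤ a → 0 ≤ b →
    |a - b| ^ (5 / 3 : ℝ) + C * ((a + b) / 2) ^ (5 / 3 : ℝ)
      ≤ C * ((a ^ (5 / 3 : ℝ) + b ^ (5 / 3 : ℝ)) / 2) + δ * (a ^ (5 / 3 : ℝ) + b ^ (5 / 3 : ℝ)) := by
  set p : ℝ := 5 / 3 with hp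
  have hp0 : 0 < p := by norm_num [hp]
  set φ : ℝ → ℝ := fun b => (1 + b ^ p) / 2 - ((1 + b) / 2) ^ p with hφ
  have hcv := strictConvexOn_rpow (show 1 < p by norm_num [hp])
  have hcont : Continuous φ := by
    have h1 : Continuous fun b : ℝ => b ^ p := Real.continuous_rpow_const hp0.le
    exact ((continuous_const.add h1).div_const 2).sub
      (h1.comp ((continuous_const.add continuous_id).div_const 2))
  have hpos : ∀ b, 0 ≤ b → b ≠ 1 → 0 < φ b := by
    intro b hb hb1
    have := hcv.2 (show (1:ℝ) ∈ Set.Ici 0 by simp) (show b ∈ Set.Ici 0 from hb) hb1.symm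
      (show (0:ℝ) < 1 / 2 by norm_num) (show (0:ℝ) < 1 / 2 by norm_num) (by norm_num)
    simp only [smul_eq_mul, Real.one_rpow] at this
    rw [show (1 / 2 : ℝ) * 1 + 1 / 2 * b = (1 + b) / 2 by ring] at this
    simp only [hφ]
    linarith
  have hnn : ∀ b, 0 ≤ b → 0 ≤ φ b := by
    intro b hb
    by_cases h1 : b = 1
    · simp [hφ, h1]
    · exact (hpos b hb h1).le
  -- By homogeneity the larger argument is taken to be 1. At b = 1 the gap φ vanishes quadratically,
  -- faster than (1 - b)^(5/3), hence the δ term; where (1 - b)^(5/3) ≥ δ, compactness bounds φ from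
  -- below.
  obtain ⟨C, hC0, hC⟩ : ∃ C : ℝ, 0 ≤ C ∧ ∀ b ∈ Set.Icc (0:ℝ) 1, (1 - b) ^ p ≤ C * φ b + δ := by
    set K : Set ℝ := Set.Icc 0 1 ∩ {b | δ ≤ (1 - b) ^ p} with hK
    have hcont2 : Continuous fun b : ℝ => (1 - b) ^ p :=
      (Real.continuous_rpow_const hp0.le).comp (by fun_prop)
    have hKc : IsCompact K := isCompact_Icc.inter_right (isClosed_le continuous_const hcont2)
    rcases K.eq_empty_or_nonempty with hKe | hKn
    · refine ⟨0, le_rfl, fun b hb => ?_⟩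
      by_contra hcon
      have : b ∈ K := ⟨hb, by
        simp only [zero_mul, zero_add, not_le] at hcon
        exact hcon.le⟩
      rw [hKe] at this
      exact this
    · obtain ⟨b0, hb0, hmin⟩ := hKc.exists_isMinOn hKn hcont.continuousOn
      have hb01 : b0 ≠ 1 := by
        rintro rfl
        have := hb0.2
        simp only [Set.mem_ofPred_eq, sub_self, Real.zero_rpow hp0.ne'] at this
        linarith
      have hm := hpos b0 hb0.1.1 hb01
      refine ⟨(φ b0)⁻¹, by positivity, fun b hb => ?_⟩
      have hle1 : (1 - b) ^ p ≤ 1 := Real.rpow_le_one (by linarith [hb.2]) (by linarith [hb.1]) hp0.le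
      by_cases hbK : δ ≤ (1 - b) ^ p
      · have h1 : φ b0 ≤ φ b := hmin ⟨hb, hbK⟩
        have : 1 ≤ (φ b0)⁻¹ * φ b := by
          rw [inv_mul_eq_div, le_div_iff₀ hm]; linarith
        linarith
      · have := mul_nonneg (inv_nonneg.2 hm.le) (hnn b hb.1)
        linarith
  refine ⟨C, hC0, ?_⟩
  have key : ∀ a b : ℝ, 0 ≤ b → b ≤ a → |a - b| ^ p + C * ((a + b) / 2) ^ p
      ≤ C * ((a ^ p + b ^ p) / 2) + δ * (a ^ p + b ^ p) := by
    intro a b hb hba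
    rcases eq_or_lt_of_le (hb.trans hba) with ha | ha
    · have hb0 : b = 0 := le_antisymm (ha ▸ hba) hb
      subst hb0
      rw [← ha]
      simp [Real.zero_rpow hp0.ne']
    have hb1 : b / a ∈ Set.Icc (0:ℝ) 1 := ⟨by positivity, (div_le_one ha).2 hba⟩
    have h := hC _ hb1
    simp only [hφ] at h
    have hap : 0 < a ^ p := Real.rpow_pos_of_pos ha _
    have e1 : (1 - b / a) ^ p = |a - b| ^ p / a ^ p := by
      rw [abs_of_nonneg (by linarith), ← Real.div_rpow (by linarith) ha.le]
      congr 1; field_simp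
    have e2 : ((1 + b / a) / 2) ^ p = ((a + b) / 2) ^ p / a ^ p := by
      rw [← Real.div_rpow (by linarith) ha.le]
      congr 1; field_simp
    have e3 : (b / a) ^ p = b ^ p / a ^ p := Real.div_rpow hb ha.le _
    rw [e1, e2, e3] at h
    have h2 := mul_le_mul_of_nonneg_right h hap.le
    have e4 : (C * ((1 + b ^ p / a ^ p) / 2 - ((a + b) / 2) ^ p / a ^ p) + δ) * a ^ p
        = C * ((a ^ p + b ^ p) / 2) - C * ((a + b) / 2) ^ p + δ * a ^ p := by
      field_simp
    rw [e4, div_mul_cancel₀ _ hap.ne'] at h2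
    have : 0 ≤ δ * b ^ p := by positivity
    linarith
  intro a b ha hb
  rcases le_total b a with h | h
  · exact key a b hb h
  · have := key b a ha h
    rw [abs_sub_comm, add_comm a b, add_comm (a ^ p)]
    exact this

/-- The average of two densities. -/
noncomputable def avg (f g : Space → ℝ≥0∞) (x : Space) : ℝ≥0∞ := 2⁻¹ * (f x + g x)

lemma measurable_avg {f g : Space → ℝ≥0∞} (hf : Measurable f) (hg : Measurable g) :
    Measurable (avg f g) := (hf.add hg).const_mul _

lemma attr_avg {f g : Space → ℝ≥0∞} (hf : Measurable f) (hg : Measurable g) :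
    attr (avg f g) = 2⁻¹ * (attr f + attr g) := by
  unfold attr avg
  rw [← lintegral_add_left (by fun_prop), ← lintegral_const_mul _ (by fun_prop)]
  exact lintegral_congr fun x => by ring

lemma lintegral_avg {f g : Space → ℝ≥0∞} (hf : Measurable f) (hg : Measurable g) :
    ∫⁻ x, avg f g x = 2⁻¹ * ((∫⁻ x, f x) + ∫⁻ x, g x) := by
  unfold avg
  rw [← lintegral_add_left hf, ← lintegral_const_mul _ (by fun_prop)]

lemma kin_avg_ne_top {f g : Space → ℝ≥0∞} (hf : Measurable f)
    (hf' : kin f ≠ ∞) (hg' : kin g ≠ ∞) : kin (avg f g) ≠ ∞ := by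
  refine ne_top_of_le_ne_top (ENNReal.add_ne_top.2 ⟨hf', hg'⟩) ?_
  unfold kin
  rw [← lintegral_add_left (by fun_prop)]
  refine lintegral_mono fun x => ?_
  have h : avg f g x ≤ max (f x) (g x) := by
    unfold avg
    calc 2⁻¹ * (f x + g x) ≤ 2⁻¹ * (max (f x) (g x) + max (f x) (g x)) := by
          gcongr
          · exact le_max_left _ _
          · exact le_max_right _ _
      _ = _ := by
          rw [← two_mul, ← mul_assoc, ENNReal.inv_mul_cancel (by norm_num) (by norm_num), one_mul]
  refine (ENNReal.rpow_le_rpow h (by norm_num)).trans ?_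
  rcases le_total (f x) (g x) with h | h
  · rw [max_eq_right h]; exact le_add_self
  · rw [max_eq_left h]; exact le_self_add

lemma Admissible.avg {f g : Space → ℝ≥0∞} (hf : Admissible f) (hg : Admissible g) :
    Admissible (avg f g) :=
  ⟨measurable_avg hf.measurable hg.measurable,
    kin_avg_ne_top hf.measurable hf.kin_ne_top hg.kin_ne_top,
    ne_top_of_le_ne_top (ENNReal.mul_ne_top (by simp)
      (ENNReal.add_ne_top.2 ⟨hf.inter_ne_top, hg.inter_ne_top⟩))
      (inter_avg_le hf.measurable hg.measurable)⟩

/-- The attraction is linear and the Coulomb term midpoint convex, so the full kinetic convexity gap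
survives. -/
lemma tfEnergy_avg_le (γ Z : ℝ) {f g : Space → ℝ≥0∞} (hf : Admissible f) (hg : Admissible g) :
    tfEnergy γ Z (avg f g) ≤ (tfEnergy γ Z f + tfEnergy γ Z g) / 2 -
      3 / 5 * γ * (((kin f).toReal + (kin g).toReal) / 2 - (kin (avg f g)).toReal) := by
  have h1 : (inter (avg f g) (avg f g)).toReal
      ≤ ((inter f f).toReal + (inter g g).toReal) / 2 := by
    have := ENNReal.toReal_mono (ENNReal.mul_ne_top (by simp)
      (ENNReal.add_ne_top.2 ⟨hf.inter_ne_top, hg.inter_ne_top⟩))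
      (inter_avg_le hf.measurable hg.measurable)
    rw [ENNReal.toReal_mul, ENNReal.toReal_add hf.inter_ne_top hg.inter_ne_top] at this
    simp only [ENNReal.toReal_inv, ENNReal.toReal_ofNat] at this
    calc _ ≤ _ := this
      _ = _ := by ring
  have h2 : (attr (avg f g)).toReal = ((attr f).toReal + (attr g).toReal) / 2 := by
    rw [attr_avg hf.measurable hg.measurable, ENNReal.toReal_mul,
      ENNReal.toReal_add (attr_ne_top hf) (attr_ne_top hg)]
    simp only [ENNReal.toReal_inv, ENNReal.toReal_ofNat]
    ring
  unfold tfEnergy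
  rw [h2]
  linarith

lemma norm_sub_rpow_le {δ : ℝ} (hδ : 0 < δ) : ∃ C : ℝ, 0 ≤ C ∧ ∀ ρ σ : Density,
    (∀ᵐ x : Space, 0 ≤ ρ x) → (∀ᵐ x : Space, 0 ≤ σ x) →
    ‖ρ - σ‖ ^ (5 / 3 : ℝ) ≤ C * (((kin (dens ρ)).toReal + (kin (dens σ)).toReal) / 2 -
      (kin (avg (dens ρ) (dens σ))).toReal) + δ * ((kin (dens ρ)).toReal + (kin (dens σ)).toReal) := by
  obtain ⟨C, hC, h⟩ := exists_uniform_convexity hδ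
  refine ⟨C, hC, fun ρ σ hρ hσ => ?_⟩
  have hk1 : kin (dens ρ) ≠ ∞ := by rw [kin_dens hρ]; exact ENNReal.ofReal_ne_top
  have hk2 : kin (dens σ) ≠ ∞ := by rw [kin_dens hσ]; exact ENNReal.ofReal_ne_top
  have hk3 := kin_avg_ne_top (measurable_dens ρ) hk1 hk2
  have hm1 := measurable_dens ρ
  have hm2 := measurable_dens σ
  have hm3 := measurable_avg hm1 hm2
  have hm4 : Measurable fun x : Space => ‖(ρ - σ) x‖ₑ ^ (5 / 3 : ℝ) :=
    (measurable_coe (ρ - σ)).enorm.pow_const _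
  have hpt : ∀ᵐ x : Space, ‖(ρ - σ) x‖ₑ ^ (5 / 3 : ℝ) +
      ENNReal.ofReal C * avg (dens ρ) (dens σ) x ^ (5 / 3 : ℝ)
      ≤ ENNReal.ofReal (C / 2 + δ) * (dens ρ x ^ (5 / 3 : ℝ) + dens σ x ^ (5 / 3 : ℝ)) := by
    filter_upwards [hρ, hσ, Lp.coeFn_sub ρ σ] with x h1 h2 h3
    have ha : avg (dens ρ) (dens σ) x = ENNReal.ofReal ((ρ x + σ x) / 2) := by
      rw [avg, dens, dens, ← ENNReal.ofReal_add h1 h2, div_eq_inv_mul,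
        ENNReal.ofReal_mul (by norm_num), ENNReal.ofReal_inv_of_pos (by norm_num)]
      simp
    have hs : ‖(ρ - σ) x‖ₑ = ENNReal.ofReal |ρ x - σ x| := by
      rw [h3, Pi.sub_apply, Real.enorm_eq_ofReal_abs]
    rw [ha, hs, dens, dens, ENNReal.ofReal_rpow_of_nonneg (abs_nonneg _) (by norm_num),
      ENNReal.ofReal_rpow_of_nonneg (by positivity) (by norm_num),
      ENNReal.ofReal_rpow_of_nonneg h1 (by norm_num),
      ENNReal.ofReal_rpow_of_nonneg h2 (by norm_num), ← ENNReal.ofReal_mul hC,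
      ← ENNReal.ofReal_add (by positivity) (by positivity),
      ← ENNReal.ofReal_add (by positivity) (by positivity),
      ← ENNReal.ofReal_mul (by positivity)]
    refine ENNReal.ofReal_le_ofReal ?_
    have := h _ _ h1 h2
    linarith
  have hint := lintegral_mono_ae hpt
  rw [lintegral_add_left hm4, lintegral_const_mul _ (by fun_prop),
    lintegral_const_mul _ (by fun_prop), lintegral_add_left (by fun_prop),
    lintegral_enorm_rpow] at hint
  change _ + ENNReal.ofReal C * kin (avg (dens ρ) (dens σ)) ≤
    _ * (kin (dens ρ) + kin (dens σ)) at hint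
  have hreal := ENNReal.toReal_mono (ENNReal.mul_ne_top ENNReal.ofReal_ne_top
    (ENNReal.add_ne_top.2 ⟨hk1, hk2⟩)) hint
  rw [ENNReal.toReal_add ENNReal.ofReal_ne_top (ENNReal.mul_ne_top ENNReal.ofReal_ne_top hk3),
    ENNReal.toReal_mul, ENNReal.toReal_mul, ENNReal.toReal_add hk1 hk2,
    ENNReal.toReal_ofReal (by positivity), ENNReal.toReal_ofReal hC,
    ENNReal.toReal_ofReal (by positivity)] at hreal
  linarith

/-- Near-minimizers of a midpoint-convex problem are close. -/
lemma norm_sub_rpow_le_energy {γ : ℝ} (hγ : 0 < γ) (Z : ℝ) {δ : ℝ} (hδ : 0 < δ) :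
    ∃ C : ℝ, 0 ≤ C ∧ ∀ ρ ∈ admissible, ∀ σ ∈ admissible, ∀ e : ℝ,
      e ≤ tfEnergy γ Z (avg (dens ρ) (dens σ)) →
      ‖ρ - σ‖ ^ (5 / 3 : ℝ) ≤ C * ((energy γ Z ρ + energy γ Z σ) / 2 - e)
        + δ * ((kin (dens ρ)).toReal + (kin (dens σ)).toReal) := by
  obtain ⟨C, hC, h⟩ := norm_sub_rpow_le hδ
  refine ⟨C / (3 / 5 * γ), by positivity, fun ρ hρ σ hσ e he => ?_⟩
  have h1 := h ρ σ (mem_admissible_iff.1 hρ).1 (mem_admissible_iff.1 hσ).1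
  have h2 := tfEnergy_avg_le γ Z (mem_admissible_iff.1 hρ).2 (mem_admissible_iff.1 hσ).2
  rw [energy_eq γ Z hρ, energy_eq γ Z hσ]
  set d := ((kin (dens ρ)).toReal + (kin (dens σ)).toReal) / 2 -
      (kin (avg (dens ρ) (dens σ))).toReal
  have h3 : 3 / 5 * γ * d ≤ (tfEnergy γ Z (dens ρ) + tfEnergy γ Z (dens σ)) / 2 - e := by linarith
  have h4 := mul_le_mul_of_nonneg_left h3 (show 0 ≤ C / (3 / 5 * γ) by positivity)
  have e1 : C / (3 / 5 * γ) * (3 / 5 * γ * d) = C * d := by field_simp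
  linarith

/-- A set of densities which contains the averages of its members. -/
def MidpointClosed (S : Set Density) : Prop :=
  ∀ ρ ∈ S, ∀ σ ∈ S, ∃ τ ∈ S, dens τ =ᵐ[volume] avg (dens ρ) (dens σ)

lemma midpointClosed_admissible : MidpointClosed admissible := by
  intro ρ hρ σ hσ
  obtain ⟨τ, hτ, h, -⟩ := exists_density_of_admissible 0 0
    ((mem_admissible_iff.1 hρ).2.avg (mem_admissible_iff.1 hσ).2)
  exact ⟨τ, hτ, h⟩

lemma midpointClosed_admissibleLE (N : ℝ) : MidpointClosed (admissibleLE N) := by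
  intro ρ hρ σ hσ
  obtain ⟨τ, hτ, h, hm, -⟩ := exists_density_of_admissible 0 0
    ((mem_admissible_iff.1 hρ.1).2.avg (mem_admissible_iff.1 hσ.1).2)
  refine ⟨τ, ⟨hτ, ?_⟩, h⟩
  rw [hm, lintegral_avg (measurable_dens ρ) (measurable_dens σ)]
  calc _ ≤ 2⁻¹ * (ENNReal.ofReal N + ENNReal.ofReal N) := by
        gcongr
        · exact hρ.2
        · exact hσ.2
    _ = _ := by
        rw [← two_mul, ← mul_assoc, ENNReal.inv_mul_cancel (by norm_num) (by norm_num), one_mul]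

lemma IsMinimizer.eq {γ : ℝ} (hγ : 0 < γ) {Z : ℝ} {S : Set Density} (hS : S ⊆ admissible)
    (hmid : MidpointClosed S) {ρ σ : Density} (hρ : IsMinimizer γ Z S ρ)
    (hσ : IsMinimizer γ Z S σ) : ρ = σ := by
  have hE : energy γ Z ρ = energy γ Z σ := le_antisymm (hρ.2 σ hσ.1) (hσ.2 ρ hρ.1)
  obtain ⟨τ, hτ, hd⟩ := hmid ρ hρ.1 σ hσ.1
  have he : energy γ Z ρ ≤ tfEnergy γ Z (avg (dens ρ) (dens σ)) := by
    rw [← tfEnergy_congr γ Z hd, ← energy_eq γ Z (hS hτ)]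
    exact hρ.2 τ hτ
  set K := (kin (dens ρ)).toReal + (kin (dens σ)).toReal with hK
  have hK0 : 0 ≤ K := by positivity
  -- Both energies equal the minimum, so only the δ term remains, and δ is arbitrary.
  have key : ∀ δ : ℝ, 0 < δ → ‖ρ - σ‖ ^ (5 / 3 : ℝ) ≤ δ * K := by
    intro δ hδ
    obtain ⟨C, -, h⟩ := norm_sub_rpow_le_energy hγ Z hδ
    have := h ρ (hS hρ.1) σ (hS hσ.1) _ he
    rw [← hE] at this
    linarith
  have h0 : ‖ρ - σ‖ ^ (5 / 3 : ℝ) ≤ 0 := by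
    refine le_of_forall_pos_le_add fun ε hε => ?_
    have := key (ε / (K + 1)) (by positivity)
    have h2 : ε / (K + 1) * K ≤ ε := by
      rw [div_mul_eq_mul_div, div_le_iff₀ (by positivity)]
      nlinarith
    linarith
  by_contra hne
  have : 0 < ‖ρ - σ‖ := norm_pos_iff.2 (sub_ne_zero.2 hne)
  have := Real.rpow_pos_of_pos this (5 / 3)
  linarith

/-! ### Existence of minimizers at bounded mass -/

/-- Coercivity of the energy at bounded mass. -/
lemma exists_energy_bound {γ Z : ℝ} (hγ : 0 < γ) (hZ : 0 ≤ Z) (N : ℝ) :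
    ∃ B : ℝ, ∀ ρ ∈ admissibleLE N,
      3 / 10 * γ * (kin (dens ρ)).toReal + (inter (dens ρ) (dens ρ)).toReal / 2
        ≤ energy γ Z ρ + B := by
  -- Then Z δ ≤ 3γ/10: the attraction consumes at most half of the kinetic energy. The summand 1
  -- covers Z = 0.
  set δ : ℝ := 3 / 10 * γ / (Z + 1) with hδ
  have hδ0 : 0 < δ := by positivity
  obtain ⟨C, hC, h⟩ := attr_le_of_mass (δ := ENNReal.ofReal δ) (by simpa using hδ0)
    ENNReal.ofReal_ne_top
  refine ⟨Z * (C.toReal + (ENNReal.ofReal N).toReal), fun ρ hρ => ?_⟩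
  have ha := (mem_admissible_iff.1 hρ.1).2
  have h1 : attr (dens ρ) ≤ ENNReal.ofReal δ * kin (dens ρ) + C + ENNReal.ofReal N :=
    (h _ ha.measurable).trans (by gcongr; exact hρ.2)
  have h2 := ENNReal.toReal_mono (ENNReal.add_ne_top.2 ⟨ENNReal.add_ne_top.2
    ⟨ENNReal.mul_ne_top ENNReal.ofReal_ne_top ha.kin_ne_top, hC⟩, ENNReal.ofReal_ne_top⟩) h1
  rw [ENNReal.toReal_add (ENNReal.add_ne_top.2
    ⟨ENNReal.mul_ne_top ENNReal.ofReal_ne_top ha.kin_ne_top, hC⟩) ENNReal.ofReal_ne_top,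
    ENNReal.toReal_add (ENNReal.mul_ne_top ENNReal.ofReal_ne_top ha.kin_ne_top) hC,
    ENNReal.toReal_mul, ENNReal.toReal_ofReal hδ0.le] at h2
  rw [energy_eq γ Z hρ.1, tfEnergy]
  have h3 := mul_le_mul_of_nonneg_left h2 hZ
  have h4 : Z * δ ≤ 3 / 10 * γ := by
    rw [hδ, mul_div_assoc', div_le_iff₀ (by positivity)]
    nlinarith
  have h5 := mul_le_mul_of_nonneg_right h4 (ENNReal.toReal_nonneg (a := kin (dens ρ)))
  nlinarith

/-- Fatou's lemma twice: for the potential at each point, then for the outer integral. -/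
lemma inter_le_of_tendsto {f : ℕ → Space → ℝ≥0∞} {g : Space → ℝ≥0∞} (hf : ∀ n, Measurable (f n))
    (h : ∀ᵐ x, Filter.Tendsto (fun n => f n x) Filter.atTop (nhds (g x))) {c : ℝ≥0∞}
    (hc : ∀ᶠ n in Filter.atTop, inter (f n) (f n) ≤ c) : inter g g ≤ c := by
  have hg : g =ᵐ[volume] fun x => Filter.liminf (fun n => f n x) Filter.atTop :=
    h.mono fun x hx => hx.liminf_eq.symm
  have hm : Measurable fun x => Filter.liminf (fun n => f n x) Filter.atTop := .liminf hf
  have hpot : ∀ x, potential (fun x => Filter.liminf (fun n => f n x) Filter.atTop) x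
      ≤ Filter.liminf (fun n => potential (f n) x) Filter.atTop := by
    intro x
    unfold potential
    refine le_trans (lintegral_mono fun y => ?_) (lintegral_liminf_le fun n => (hf n).mul (by fun_prop))
    have := ENNReal.le_liminf_mul (f := Filter.atTop) (u := fun n => f n y)
      (v := fun _ : ℕ => kern (x - y))
    rw [Filter.liminf_const] at this
    exact this
  calc inter g g = _ := inter_congr hg hg
    _ ≤ ∫⁻ x, Filter.liminf (fun n => f n x * potential (f n) x) Filter.atTop := by
        refine lintegral_mono fun x => ?_
        refine (mul_le_mul_right (hpot x) _).trans ?_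
        exact ENNReal.le_liminf_mul
    _ ≤ Filter.liminf (fun n => inter (f n) (f n)) Filter.atTop :=
        lintegral_liminf_le fun n => (hf n).mul (measurable_potential (hf n))
    _ ≤ c := Filter.liminf_le_of_frequently_le' hc.frequently

lemma lintegral_le_of_tendsto {f : ℕ → Space → ℝ≥0∞} {g : Space → ℝ≥0∞}
    (hf : ∀ n, Measurable (f n))
    (h : ∀ᵐ x, Filter.Tendsto (fun n => f n x) Filter.atTop (nhds (g x))) {c : ℝ≥0∞}
    (hc : ∀ᶠ n in Filter.atTop, ∫⁻ x, f n x ≤ c) : ∫⁻ x, g x ≤ c :=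
  calc ∫⁻ x, g x = ∫⁻ x, Filter.liminf (fun n => f n x) Filter.atTop :=
        lintegral_congr_ae (h.mono fun _ hx => hx.liminf_eq.symm)
    _ ≤ Filter.liminf (fun n => ∫⁻ x, f n x) Filter.atTop := lintegral_liminf_le hf
    _ ≤ c := Filter.liminf_le_of_frequently_le' hc.frequently

/-- The attraction is upper semicontinuous in `L^{5/3}` at bounded mass. -/
lemma attr_le_add_norm_sub (R : ℝ) : ∃ C : ℝ, 0 ≤ C ∧ ∀ ρ σ : Density,
    (∀ᵐ x : Space, 0 ≤ ρ x) →
    attr (dens ρ) ≤ attr (dens σ) + ENNReal.ofReal (C * ‖ρ - σ‖) + mass ρ * (ENNReal.ofReal R)⁻¹ := by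
  set κ := ∫⁻ x in Metric.ball (0 : Space) R, kern x ^ (5 / 2 : ℝ) with hκ
  have hκt : κ ^ (1 / (5 / 2) : ℝ) ≠ ∞ :=
    ENNReal.rpow_ne_top_of_nonneg (by norm_num) (setLIntegral_ball_kern_rpow R)
  refine ⟨(κ ^ (1 / (5 / 2) : ℝ)).toReal, ENNReal.toReal_nonneg, fun ρ σ hρ => ?_⟩
  have hmd : Measurable fun x : Space => ‖(ρ - σ) x‖ₑ := (measurable_coe (ρ - σ)).enorm
  rw [attr_eq_add (dens ρ) R]
  refine add_le_add ?_ ((setLIntegral_compl_ball_attr_le (measurable_dens ρ) R).trans ?_)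
  · have hpt : ∀ᵐ x : Space, dens ρ x * kern x ≤ dens σ x * kern x + ‖(ρ - σ) x‖ₑ * kern x := by
      filter_upwards [Lp.coeFn_sub ρ σ] with x hx
      rw [← add_mul]
      gcongr
      rw [hx, Pi.sub_apply, Real.enorm_eq_ofReal_abs, dens, dens]
      calc ENNReal.ofReal (ρ x) = ENNReal.ofReal (σ x + (ρ x - σ x)) := by ring_nf
        _ ≤ _ := ENNReal.ofReal_add_le.trans (by gcongr; exact le_abs_self _)
    calc _ ≤ ∫⁻ x in Metric.ball (0 : Space) R, (dens σ x * kern x + ‖(ρ - σ) x‖ₑ * kern x) :=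
          lintegral_mono_ae (ae_restrict_of_ae hpt)
      _ = (∫⁻ x in Metric.ball (0 : Space) R, dens σ x * kern x) +
          ∫⁻ x in Metric.ball (0 : Space) R, ‖(ρ - σ) x‖ₑ * kern x :=
          lintegral_add_left ((measurable_dens σ).mul measurable_kern) _
      _ ≤ attr (dens σ) + (∫⁻ x, ‖(ρ - σ) x‖ₑ ^ (5 / 3 : ℝ)) ^ (1 / (5 / 3) : ℝ) *
          κ ^ (1 / (5 / 2) : ℝ) := by
          refine add_le_add (setLIntegral_le_lintegral _ _) ?_
          have hpq : (5 / 3 : ℝ).HolderConjugate (5 / 2) := by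
            rw [Real.holderConjugate_iff]; norm_num
          refine (ENNReal.lintegral_mul_le_Lp_mul_Lq (volume.restrict (Metric.ball (0 : Space) R)) hpq
            hmd.aemeasurable measurable_kern.aemeasurable).trans ?_
          gcongr
          exact Measure.restrict_le_self
      _ = _ := by
          rw [lintegral_enorm_rpow, ENNReal.ofReal_rpow_of_nonneg (by positivity) (by norm_num),
            ← Real.rpow_mul (norm_nonneg _), mul_comm (ENNReal.ofReal _),
            ENNReal.ofReal_mul ENNReal.toReal_nonneg, ENNReal.ofReal_toReal hκt]
          norm_num
  · gcongr
    exact setLIntegral_le_lintegral _ _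

/-- The kinetic term is norm continuous, the attraction is upper semicontinuous up to a mass tail of
order N/R, and the Coulomb term is lower semicontinuous by Fatou along an a.e. convergent
subsequence. -/
lemma lsc_of_tendsto {γ Z : ℝ} (hγ : 0 < γ) (hZ : 0 ≤ Z) (N : ℝ) {u : ℕ → Density}
    {ρ : Density} {e : ℝ} (hu : ∀ n, u n ∈ admissibleLE N)
    (hlim : Filter.Tendsto u Filter.atTop (nhds ρ))
    (hE : Filter.Tendsto (fun n => energy γ Z (u n)) Filter.atTop (nhds e)) :
    ρ ∈ admissibleLE N ∧ energy γ Z ρ ≤ e := by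
  obtain ⟨v, hu, hlim, hE, hae⟩ : ∃ v : ℕ → Density, (∀ n, v n ∈ admissibleLE N) ∧
      Filter.Tendsto v Filter.atTop (nhds ρ) ∧
      Filter.Tendsto (fun n => energy γ Z (v n)) Filter.atTop (nhds e) ∧
      ∀ᵐ x, Filter.Tendsto (fun n => v n x) Filter.atTop (nhds (ρ x)) := by
    obtain ⟨ns, hns, hae⟩ := (tendstoInMeasure_of_tendsto_Lp hlim).exists_seq_tendsto_ae
    exact ⟨fun n => u (ns n), fun n => hu _, hlim.comp hns.tendsto_atTop,
      hE.comp hns.tendsto_atTop, hae⟩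
  have h0n : ∀ n, ∀ᵐ x : Space, 0 ≤ v n x := fun n => (mem_admissible_iff.1 (hu n).1).1
  have h0 : ∀ᵐ x : Space, 0 ≤ ρ x := by
    filter_upwards [hae, ae_all_iff.2 h0n] with x hx hx0
    exact ge_of_tendsto' hx hx0
  have hd : ∀ᵐ x, Filter.Tendsto (fun n => dens (v n) x) Filter.atTop (nhds (dens ρ x)) :=
    hae.mono fun x hx => ENNReal.tendsto_ofReal hx
  have hmv : ∀ n, Measurable (dens (v n)) := fun n => measurable_dens _
  have hmass : mass ρ ≤ ENNReal.ofReal N :=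
    lintegral_le_of_tendsto hmv hd (Filter.Eventually.of_forall fun n => (hu n).2)
  obtain ⟨B, hB⟩ := exists_energy_bound hγ hZ N
  have hfin : ∀ n, inter (dens (v n)) (dens (v n)) ≠ ∞ :=
    fun n => (mem_admissible_iff.1 (hu n).1).2.inter_ne_top
  have hle_of : ∀ c : ℝ, (∀ᶠ n in Filter.atTop, (inter (dens (v n)) (dens (v n))).toReal ≤ c) →
      inter (dens ρ) (dens ρ) ≤ ENNReal.ofReal c := by
    intro c hc
    refine inter_le_of_tendsto hmv hd (hc.mono fun n hn => ?_)
    rw [← ENNReal.ofReal_toReal (hfin n)]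
    exact ENNReal.ofReal_le_ofReal hn
  have hadm : ρ ∈ admissible := by
    refine mem_admissible_iff.2 ⟨h0, measurable_dens ρ, ?_, ?_⟩
    · rw [kin_dens h0]; exact ENNReal.ofReal_ne_top
    · refine ne_top_of_le_ne_top ENNReal.ofReal_ne_top (hle_of (2 * (e + 1 + B)) ?_)
      filter_upwards [hE.eventually (gt_mem_nhds (show e < e + 1 by linarith))] with n hn
      have h1 := hB _ (hu n)
      have h2 : 0 ≤ 3 / 10 * γ * (kin (dens (v n))).toReal := by positivity
      linarith
  refine ⟨⟨hadm, hmass⟩, ?_⟩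
  have ha := (mem_admissible_iff.1 hadm).2
  have hk : Filter.Tendsto (fun n => (kin (dens (v n))).toReal) Filter.atTop
      (nhds (kin (dens ρ)).toReal) := by
    rw [kin_dens h0, ENNReal.toReal_ofReal (by positivity)]
    have : (fun n => (kin (dens (v n))).toReal) = fun n => ‖v n‖ ^ (5 / 3 : ℝ) := by
      funext n
      rw [kin_dens (h0n n), ENNReal.toReal_ofReal (by positivity)]
    rw [this]
    exact (Real.continuous_rpow_const (by norm_num)).continuousAt.tendsto.comp hlim.norm
  have hdist : Filter.Tendsto (fun n => ‖v n - ρ‖) Filter.atTop (nhds 0) :=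
    tendsto_iff_norm_sub_tendsto_zero.1 hlim
  have key : ∀ ε : ℝ, 0 < ε → energy γ Z ρ ≤ e + ε * (1 + 3 / 5 * γ + 2 * Z) := by
    intro ε hε
    set M := (ENNReal.ofReal N).toReal with hM
    -- The tail of the attraction is at most M/R ≤ ε.
    set R : ℝ := (M + 1) / ε with hR
    have hM0 : 0 ≤ M := ENNReal.toReal_nonneg
    have hR0 : 0 < R := by positivity
    obtain ⟨C, hC0, hC⟩ := attr_le_add_norm_sub R
    have hdC : Filter.Tendsto (fun n => C * ‖v n - ρ‖) Filter.atTop (nhds 0) := by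
      simpa using hdist.const_mul C
    -- The energy is solved for its Coulomb term, so that Fatou is applied to an eventual numerical
    -- bound.
    have hev : ∀ᶠ n in Filter.atTop, (inter (dens (v n)) (dens (v n))).toReal ≤
        2 * (e + ε - 3 / 5 * γ * ((kin (dens ρ)).toReal - ε) + Z * ((attr (dens ρ)).toReal + 2 * ε)) := by
      filter_upwards [hE.eventually (gt_mem_nhds (show e < e + ε by linarith)),
        hk.eventually (lt_mem_nhds (show (kin (dens ρ)).toReal - ε < (kin (dens ρ)).toReal by linarith)),
        hdC.eventually (gt_mem_nhds hε)] with n h1 h2 h3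
      rw [energy_eq γ Z (hu n).1, tfEnergy] at h1
      have h4 : (attr (dens (v n))).toReal ≤ (attr (dens ρ)).toReal + 2 * ε := by
        have h5 : attr (dens (v n)) ≤ attr (dens ρ) + ENNReal.ofReal ε + ENNReal.ofReal ε := by
          refine (hC (v n) ρ (h0n n)).trans ?_
          gcongr
          calc mass (v n) * (ENNReal.ofReal R)⁻¹ ≤ ENNReal.ofReal M * (ENNReal.ofReal R)⁻¹ := by
                gcongr
                rw [hM, ENNReal.ofReal_toReal ENNReal.ofReal_ne_top]
                exact (hu n).2
            _ = ENNReal.ofReal (M / R) := by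
                rw [ENNReal.ofReal_div_of_pos hR0, div_eq_mul_inv]
            _ ≤ _ := ENNReal.ofReal_le_ofReal (by
                rw [hR, div_div_eq_mul_div, div_le_iff₀ (by positivity)]
                nlinarith)
        have h6 := ENNReal.toReal_mono (ENNReal.add_ne_top.2 ⟨ENNReal.add_ne_top.2
          ⟨attr_ne_top ha, ENNReal.ofReal_ne_top⟩, ENNReal.ofReal_ne_top⟩) h5
        rw [ENNReal.toReal_add (ENNReal.add_ne_top.2 ⟨attr_ne_top ha, ENNReal.ofReal_ne_top⟩)
          ENNReal.ofReal_ne_top, ENNReal.toReal_add (attr_ne_top ha) ENNReal.ofReal_ne_top,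
          ENNReal.toReal_ofReal hε.le] at h6
        linarith
      have h7 := mul_le_mul_of_nonneg_left h4 hZ
      have h8 := mul_le_mul_of_nonneg_left h2.le (show 0 ≤ 3 / 5 * γ by positivity)
      linarith
    have hi := hle_of _ hev
    -- A single index shows that the bound is nonnegative, so `ENNReal.ofReal` does not truncate it.
    obtain ⟨n, hn⟩ := hev.exists
    have hpos := ENNReal.toReal_nonneg.trans hn
    have hi2 := ENNReal.toReal_le_of_le_ofReal hpos hi
    rw [energy_eq γ Z hadm, tfEnergy]
    linarith
  refine le_of_forall_pos_le_add fun η hη => ?_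
  have hD : 0 < 1 + 3 / 5 * γ + 2 * Z := by positivity
  have := key (η / (1 + 3 / 5 * γ + 2 * Z)) (by positivity)
  rwa [div_mul_cancel₀ _ hD.ne'] at this

lemma admissible_zero : Admissible 0 :=
  ⟨measurable_const, by simp [kin], by simp [inter]⟩

lemma admissibleLE_nonempty (N : ℝ) : (admissibleLE N).Nonempty := by
  obtain ⟨ρ, hρ, -, hm, -⟩ := exists_density_of_admissible 0 0 admissible_zero
  exact ⟨ρ, hρ, by rw [hm]; simp⟩

lemma exists_isMinimizer {γ Z : ℝ} (hγ : 0 < γ) (hZ : 0 ≤ Z) (N : ℝ) :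
    ∃ ρ, IsMinimizer γ Z (admissibleLE N) ρ := by
  obtain ⟨B, hB⟩ := exists_energy_bound hγ hZ N
  set S := energy γ Z '' admissibleLE N with hS
  have hne : S.Nonempty := (admissibleLE_nonempty N).image _
  have hbdd : BddBelow S := by
    refine ⟨-B, ?_⟩
    rintro _ ⟨ρ, hρ, rfl⟩
    have h1 := hB ρ hρ
    have h2 : 0 ≤ 3 / 10 * γ * (kin (dens ρ)).toReal + (inter (dens ρ) (dens ρ)).toReal / 2 := by
      positivity
    linarith
  set e := sInf S with he
  have hle : ∀ σ ∈ admissibleLE N, e ≤ energy γ Z σ := fun σ hσ => csInf_le hbdd ⟨σ, hσ, rfl⟩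
  have hex : ∀ n : ℕ, ∃ ρ ∈ admissibleLE N, energy γ Z ρ < e + 1 / ((n : ℝ) + 1) := by
    intro n
    obtain ⟨_, ⟨ρ, hρ, rfl⟩, h⟩ := exists_lt_of_csInf_lt hne
      (show sInf S < e + 1 / ((n : ℝ) + 1) by linarith [show (0:ℝ) < 1 / ((n : ℝ) + 1) by positivity])
    exact ⟨ρ, hρ, h⟩
  choose u hu hue using hex
  have htend := tendsto_one_div_add_atTop_nhds_zero_nat (𝕜 := ℝ)
  have hE : Filter.Tendsto (fun n => energy γ Z (u n)) Filter.atTop (nhds e) := by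
    refine tendsto_of_tendsto_of_tendsto_of_le_of_le tendsto_const_nhds
      (by simpa using htend.const_add e) (fun n => hle _ (hu n)) (fun n => (hue n).le)
  set K : ℝ := (e + 1 + B) / (3 / 10 * γ) with hK
  have hkin : ∀ n, (kin (dens (u n))).toReal ≤ K := by
    intro n
    rw [hK, le_div_iff₀ (by positivity)]
    have h1 := hB _ (hu n)
    have h2 : 0 ≤ (inter (dens (u n)) (dens (u n))).toReal := ENNReal.toReal_nonneg
    have h3 : 1 / ((n : ℝ) + 1) ≤ 1 := by
      rw [div_le_one (by positivity)]; linarith [n.cast_nonneg (α := ℝ)]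
    linarith [hue n]
  have hK0 : 0 ≤ K := ENNReal.toReal_nonneg.trans (hkin 0)
  have hcau : CauchySeq u := by
    refine Metric.cauchySeq_iff.2 fun ε hε => ?_
    have hεp : 0 < ε ^ (5 / 3 : ℝ) := by positivity
    -- All kinetic energies are at most K, so the δ term stays below half of ε^(5/3); the energy
    -- tolerance chosen next takes the other half.
    set δ : ℝ := ε ^ (5 / 3 : ℝ) / (4 * (K + 1)) with hδ
    obtain ⟨C, hC0, hC⟩ := norm_sub_rpow_le_energy hγ Z (show 0 < δ by positivity)
    obtain ⟨n0, hn0⟩ := Filter.eventually_atTop.1 (hE.eventually (gt_mem_nhds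
      (show e < e + ε ^ (5 / 3 : ℝ) / (2 * (C + 1)) by
        linarith [show 0 < ε ^ (5 / 3 : ℝ) / (2 * (C + 1)) by positivity])))
    refine ⟨n0, fun m hm n hn => ?_⟩
    obtain ⟨τ, hτ, hd⟩ := midpointClosed_admissibleLE N _ (hu m) _ (hu n)
    have h1 := hC _ (hu m).1 _ (hu n).1 e (by
      rw [← tfEnergy_congr γ Z hd, ← energy_eq γ Z hτ.1]; exact hle _ hτ)
    have h2 : (energy γ Z (u m) + energy γ Z (u n)) / 2 - e ≤ ε ^ (5 / 3 : ℝ) / (2 * (C + 1)) := by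
      linarith [hn0 m hm, hn0 n hn]
    have h3 : C * (ε ^ (5 / 3 : ℝ) / (2 * (C + 1))) ≤ ε ^ (5 / 3 : ℝ) / 2 := by
      rw [mul_div_assoc', div_le_div_iff₀ (by positivity) (by positivity)]
      nlinarith
    have h4 : δ * ((kin (dens (u m))).toReal + (kin (dens (u n))).toReal) < ε ^ (5 / 3 : ℝ) / 2 := by
      have : δ * ((kin (dens (u m))).toReal + (kin (dens (u n))).toReal) ≤ δ * (2 * K) := by
        gcongr
        linarith [hkin m, hkin n]
      refine this.trans_lt ?_
      rw [hδ, div_mul_eq_mul_div, div_lt_div_iff₀ (by positivity) (by positivity)]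
      nlinarith
    have h5 := mul_le_mul_of_nonneg_left h2 hC0
    rw [dist_eq_norm]
    refine (Real.rpow_lt_rpow_iff (norm_nonneg _) hε.le (show (0:ℝ) < 5 / 3 by norm_num)).1 ?_
    linarith
  obtain ⟨ρ, hρ⟩ := cauchySeq_tendsto_of_complete hcau
  obtain ⟨h1, h2⟩ := lsc_of_tendsto hγ hZ N hu hρ hE
  exact ⟨ρ, h1, fun σ hσ => h2.trans (hle σ hσ)⟩

lemma isMinimizer_iff {γ Z : ℝ} (hγ : 0 < γ) {S : Set Density} (hS : S ⊆ admissible)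
    (hmid : MidpointClosed S) {ρ : Density} (hρ : IsMinimizer γ Z S ρ) (σ : Density) :
    IsMinimizer γ Z S σ ↔ σ = ρ :=
  ⟨fun h => h.eq hγ hS hmid hρ, fun h => h ▸ hρ⟩

/-- Comparison of a minimizer with `ℝ≥0∞`-valued competitors. -/
lemma IsMinimizer.le_tfEnergy {γ Z N : ℝ} {ρ : Density} (h : IsMinimizer γ Z (admissibleLE N) ρ)
    {f : Space → ℝ≥0∞} (hf : Admissible f) (hm : ∫⁻ x, f x ≤ ENNReal.ofReal N) :
    tfEnergy γ Z (dens ρ) ≤ tfEnergy γ Z f := by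
  obtain ⟨τ, hτ, -, hmτ, hE⟩ := exists_density_of_admissible γ Z hf
  rw [← hE, ← energy_eq γ Z h.1.1]
  exact h.2 τ ⟨hτ, hmτ ▸ hm⟩

/-! ### Radial symmetry of minimizers -/

lemma inter_comp_isometry (L : Space ≃ₗᵢ[ℝ] Space) {f g : Space → ℝ≥0∞} (hf : Measurable f)
    (hg : Measurable g) : inter (f ∘ L) (g ∘ L) = inter f g := by
  have hk : ∀ x, kern (L x) = kern x := fun x => by
    simp only [kern, enorm_eq_nnnorm, L.nnnorm_map]
  have hp : ∀ x, potential (g ∘ L) x = potential g (L x) := by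
    intro x
    unfold potential
    rw [← L.measurePreserving.lintegral_comp (f := fun y => g y * kern (L x - y)) (by fun_prop)]
    refine lintegral_congr fun y => ?_
    rw [← map_sub, hk, Function.comp_apply]
  unfold inter
  rw [← L.measurePreserving.lintegral_comp (hf.fun_mul (measurable_potential hg))]
  refine lintegral_congr fun x => ?_
  rw [hp, Function.comp_apply]

lemma kin_comp_isometry (L : Space ≃ₗᵢ[ℝ] Space) {f : Space → ℝ≥0∞} (hf : Measurable f) :
    kin (f ∘ L) = kin f :=
  L.measurePreserving.lintegral_comp (hf.pow_const _)

lemma attr_comp_isometry (L : Space ≃ₗᵢ[ℝ] Space) {f : Space → ℝ≥0∞} (hf : Measurable f) :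
    attr (f ∘ L) = attr f := by
  unfold attr
  rw [← L.measurePreserving.lintegral_comp (hf.fun_mul measurable_kern)]
  refine lintegral_congr fun x => ?_
  simp only [Function.comp_apply, kern, enorm_eq_nnnorm, L.nnnorm_map]

/-- The rotated density has the same mass and energy, so uniqueness identifies the two. -/
lemma IsMinimizer.dens_comp_isometry {γ Z N : ℝ} (hγ : 0 < γ) {ρ : Density}
    (h : IsMinimizer γ Z (admissibleLE N) ρ) (L : Space ≃ₗᵢ[ℝ] Space) :
    dens ρ ∘ L =ᵐ[volume] dens ρ := by
  have ha := (mem_admissible_iff.1 h.1.1).2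
  have hm := ha.measurable
  have hL : Admissible (dens ρ ∘ L) :=
    ⟨hm.comp L.continuous.measurable, by rw [kin_comp_isometry L hm]; exact ha.kin_ne_top, by
      rw [inter_comp_isometry L hm hm]; exact ha.inter_ne_top⟩
  obtain ⟨τ, hτ, hd, hmτ, hE⟩ := exists_density_of_admissible γ Z hL
  have hmass : mass τ = mass ρ := by
    rw [hmτ]; exact L.measurePreserving.lintegral_comp hm
  have hEq : energy γ Z τ = energy γ Z ρ := by
    rw [hE, energy_eq γ Z h.1.1, tfEnergy, tfEnergy, kin_comp_isometry L hm,
      inter_comp_isometry L hm hm, attr_comp_isometry L hm]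
  have hmin : IsMinimizer γ Z (admissibleLE N) τ :=
    ⟨⟨hτ, hmass.trans_le h.1.2⟩, fun σ hσ => hEq.trans_le (h.2 σ hσ)⟩
  have := hmin.eq hγ (fun _ h => h.1) (midpointClosed_admissibleLE N) h
  rw [this] at hd
  exact hd.symm

/-- An integrable function that is invariant under all isometries depends on the norm only. -/
lemma exists_radial {f : Space → ℝ≥0∞} (hf : Measurable f) (hfi : ∫⁻ x, f x ≠ ∞)
    (hinv : ∀ L : Space ≃ₗᵢ[ℝ] Space, f ∘ L =ᵐ[volume] f) :
    ∃ k : ℝ → ℝ≥0∞, Measurable k ∧ f =ᵐ[volume] fun x => k ‖x‖ := by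
  set r : ℕ → ℝ := fun n => 1 / ((n : ℝ) + 1) with hr
  have hr0 : ∀ n, 0 < r n := fun n => by simp only [hr]; positivity
  -- Ball averages are invariant at every point, not merely almost everywhere, hence determined by
  -- their values on one ray. By Lebesgue differentiation they recover f a.e.
  set a : ℕ → Space → ℝ≥0∞ := fun n x =>
    (∫⁻ y in Metric.closedBall x (r n), f y) / volume (Metric.closedBall (0 : Space) (r n)) with ha
  have hainv : ∀ n (L : Space ≃ₗᵢ[ℝ] Space) x, a n (L x) = a n x := by
    intro n L x
    simp only [ha]
    congr 1
    rw [← L.measurePreserving.setLIntegral_comp_preimage measurableSet_closedBall hf]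
    rw [L.preimage_closedBall, L.symm_apply_apply]
    exact lintegral_congr_ae (ae_restrict_of_ae (hinv L))
  have ham : ∀ n, Measurable (a n) := by
    intro n
    refine Measurable.div_const ?_ _
    have hS : MeasurableSet {q : Space × Space | dist q.2 q.1 ≤ r n} :=
      measurableSet_le (by fun_prop) measurable_const
    have : Measurable ({q : Space × Space | dist q.2 q.1 ≤ r n}.indicator fun q => f q.2) :=
      (hf.comp measurable_snd).indicator hS
    have h2 := this.lintegral_prod_right' (ν := (volume : Measure Space))
    convert h2 using 1
    funext x
    rw [← lintegral_indicator measurableSet_closedBall]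
    rfl
  set e : Space := EuclideanSpace.single 0 1 with he
  have hnorm : ‖e‖ = 1 := by simp [he]
  have hab : ∀ n x, a n x = a n (‖x‖ • e) := by
    intro n x
    obtain ⟨L, hL⟩ := exists_isometry_apply_eq (x := x) (y := ‖x‖ • e)
      (by rw [norm_smul, hnorm]; simp)
    rw [← hL, hainv]
  refine ⟨fun s => Filter.limsup (fun n => a n (s • e)) Filter.atTop,
    Measurable.limsup fun n => (ham n).comp (by fun_prop), ?_⟩
  have hLeb := (IsUnifLocDoublingMeasure.vitaliFamily (volume : Measure Space) 1).ae_tendsto_lintegral_div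
    hf.aemeasurable hfi
  filter_upwards [hLeb] with x hx
  have hrt : Filter.Tendsto r Filter.atTop (nhdsWithin 0 (Set.Ioi 0)) :=
    tendsto_nhdsWithin_iff.2 ⟨tendsto_one_div_add_atTop_nhds_zero_nat,
      Filter.Eventually.of_forall hr0⟩
  have ht := hx.comp (IsUnifLocDoublingMeasure.tendsto_closedBall_filterAt (volume : Measure Space)
    (K := 1) (x := x) (fun _ : ℕ => x) r hrt (Filter.Eventually.of_forall fun n => by
      simpa using (hr0 n).le))
  have : (fun n => a n (‖x‖ • e)) = ((fun s => (∫⁻ y in s, f y) / volume s) ∘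
      fun n => Metric.closedBall x (r n)) := by
    funext n
    rw [← hab]
    simp only [ha, Function.comp_apply]
    rw [Measure.addHaar_closedBall_center _ x]
  rw [this, ht.limsup_eq]

/-! ### Upper bound on the mass: screening of the nucleus -/

/-- The strict inequality leaves charge outside the ball. Space is cut into shells of equal volume,
so thin that by absolute continuity each carries less than m - z; at the first radius where the
inner mass reaches z, the overshoot is less than m - z. -/
lemma exists_radius {f : Space → ℝ≥0∞} (hfi : ∫⁻ x, f x ≠ ∞) {z : ℝ≥0∞}
    (hz : z < ∫⁻ x, f x) : ∃ r : ℝ, z ≤ ∫⁻ x in Metric.closedBall (0 : Space) r, f x ∧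
      ∫⁻ x in Metric.closedBall (0 : Space) r, f x < ∫⁻ x, f x := by
  set m := ∫⁻ x, f x with hm
  have hzt : z ≠ ∞ := hz.ne_top
  obtain ⟨δ, hδ, hδs⟩ := exists_pos_setLIntegral_lt_of_measure_lt hfi (tsub_pos_of_lt hz).ne'
  set b := volume (Metric.ball (0 : Space) 1) with hb
  have hbt : b ≠ ∞ := measure_ball_lt_top.ne
  obtain ⟨c, hc0, hc⟩ : ∃ c : ℝ, 0 < c ∧ ENNReal.ofReal c * b < δ := by
    have ht : Filter.Tendsto (fun c : ℝ => ENNReal.ofReal c * b) (nhdsWithin 0 (Set.Ioi 0))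
        (nhds 0) := by
      have h1 : Filter.Tendsto (fun c : ℝ => ENNReal.ofReal c) (nhdsWithin 0 (Set.Ioi 0))
          (nhds 0) := by
        have := (ENNReal.continuous_ofReal.tendsto 0).mono_left
          (nhdsWithin_le_nhds (s := Set.Ioi (0:ℝ)))
        simpa using this
      simpa using ENNReal.Tendsto.mul_const h1 (Or.inr hbt)
    obtain ⟨c, h1, h2⟩ := ((ht.eventually (gt_mem_nhds hδ)).and self_mem_nhdsWithin).exists
    exact ⟨c, h2, h1⟩
  -- The cubes of the radii form an arithmetic progression, so consecutive shells all have volume c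
  -- times that of the unit ball.
  set r : ℕ → ℝ := fun n => (n * c) ^ (1 / 3 : ℝ) with hr
  have hr0 : ∀ n, 0 ≤ r n := fun n => by simp only [hr]; positivity
  have hr3 : ∀ n, r n ^ 3 = n * c := fun n => by
    simp only [hr]
    rw [← Real.rpow_natCast, ← Real.rpow_mul (by positivity)]
    norm_num
  have hrmono : Monotone r := fun i j hij => by
    simp only [hr]
    have : (i : ℝ) ≤ j := by exact_mod_cast hij
    gcongr
  have hrtop : Filter.Tendsto r Filter.atTop Filter.atTop :=
    (tendsto_rpow_atTop (by norm_num : (0:ℝ) < 1 / 3)).comp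
      (tendsto_natCast_atTop_atTop.atTop_mul_const hc0)
  have hvol : ∀ n, volume (Metric.closedBall (0 : Space) (r n)) = ENNReal.ofReal (n * c) * b := by
    intro n
    rw [Measure.addHaar_closedBall _ _ (hr0 n)]
    simp [hr3, hb]
  have hshell : ∀ n : ℕ, ∫⁻ x in Metric.closedBall (0 : Space) (r (n + 1)) \
      Metric.closedBall 0 (r n), f x < m - z := by
    intro n
    refine hδs _ (lt_of_eq_of_lt ?_ hc)
    rw [measure_sdiff (Metric.closedBall_subset_closedBall (hrmono n.le_succ))
      measurableSet_closedBall.nullMeasurableSet measure_closedBall_lt_top.ne, hvol, hvol,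
      ← ENNReal.sub_mul (fun _ _ => hbt), ← ENNReal.ofReal_sub _ (by positivity)]
    congr 2
    push_cast; ring
  have hlim : Filter.Tendsto (fun n => ∫⁻ x in Metric.closedBall (0 : Space) (r n), f x)
      Filter.atTop (nhds m) := by
    have hU : ⋃ n, Metric.closedBall (0 : Space) (r n) = Set.univ := by
      refine Set.eq_univ_of_forall fun x => Set.mem_iUnion.2 ?_
      obtain ⟨n, hn⟩ := (hrtop.eventually_ge_atTop ‖x‖).exists
      exact ⟨n, by simpa using hn⟩
    have h1 : Filter.Tendsto (fun n => (volume.withDensity f) (Metric.closedBall (0 : Space) (r n)))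
        Filter.atTop (nhds ((volume.withDensity f) (⋃ n, Metric.closedBall (0 : Space) (r n)))) :=
      tendsto_measure_iUnion_atTop fun i j hij =>
        Metric.closedBall_subset_closedBall (hrmono hij)
    rw [hU, withDensity_apply _ MeasurableSet.univ, setLIntegral_univ] at h1
    refine h1.congr fun n => ?_
    rw [withDensity_apply _ measurableSet_closedBall]
  have hex : ∃ n, z ≤ ∫⁻ x in Metric.closedBall (0 : Space) (r n), f x :=
    ((hlim.eventually (lt_mem_nhds hz)).exists).imp fun n h => h.le
  classical
  refine ⟨r (Nat.find hex), Nat.find_spec hex, ?_⟩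
  rcases hn : Nat.find hex with _ | n
  · have : volume (Metric.closedBall (0 : Space) (r 0)) = 0 := by rw [hvol]; simp
    rw [setLIntegral_measure_zero _ _ this]
    exact (zero_le).trans_lt hz
  · have h1 : ∫⁻ x in Metric.closedBall (0 : Space) (r n), f x < z := by
      have := Nat.find_min hex (m := n) (by omega)
      exact not_le.1 this
    rw [← lintegral_inter_add_sdiff f _ (measurableSet_closedBall (x := (0 : Space)) (ε := r n)),
      Set.inter_eq_self_of_subset_right (Metric.closedBall_subset_closedBall (hrmono n.le_succ))]
    calc _ < z + (m - z) := ENNReal.add_lt_add h1 (hshell n)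
      _ = m := add_tsub_cancel_of_le hz.le

lemma Admissible.mono {f g : Space → ℝ≥0∞} (hf : Admissible f) (hg : Measurable g) (h : g ≤ f) :
    Admissible g :=
  ⟨hg, ne_top_of_le_ne_top hf.kin_ne_top
    (lintegral_mono fun x => ENNReal.rpow_le_rpow (h x) (by norm_num)),
    ne_top_of_le_ne_top hf.inter_ne_top (inter_mono h h)⟩

lemma kin_eq_indicator_add {f : Space → ℝ≥0∞} {s : Set Space} (hs : MeasurableSet s) :
    kin f = kin (s.indicator f) + kin (sᶜ.indicator f) := by
  have e : ∀ t : Set Space, MeasurableSet t → kin (t.indicator f) = ∫⁻ x in t, f x ^ (5 / 3 : ℝ) := by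
    intro t ht
    rw [← lintegral_indicator ht]
    refine lintegral_congr fun x => ?_
    by_cases hx : x ∈ t <;> simp [hx]
  rw [e s hs, e _ hs.compl]
  exact (lintegral_add_compl _ hs).symm

/-- A minimizer at bounded mass carries at most the nuclear charge. -/
lemma IsMinimizer.mass_le {γ Z N : ℝ} (hγ : 0 < γ) (hZ : 0 ≤ Z) {ρ : Density}
    (h : IsMinimizer γ Z (admissibleLE N) ρ) : mass ρ ≤ ENNReal.ofReal Z := by
  by_contra! hcon
  have hmass : mass ρ ≠ ∞ := ne_top_of_le_ne_top ENNReal.ofReal_ne_top h.1.2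
  obtain ⟨k, hk, hfk⟩ := exists_radial (measurable_dens ρ) hmass (h.dens_comp_isometry hγ)
  set f : Space → ℝ≥0∞ := fun x => k ‖x‖ with hf
  have hfm : Measurable f := hk.comp measurable_norm
  have hfa : Admissible f := (mem_admissible_iff.1 h.1.1).2.congr hfm hfk
  have hmf : mass ρ = ∫⁻ x, f x := lintegral_congr_ae hfk
  rw [hmf] at hcon hmass
  obtain ⟨r, hr1, hr2⟩ := exists_radius hmass hcon
  set B := Metric.closedBall (0 : Space) r with hB
  have hBm : MeasurableSet B := measurableSet_closedBall
  set fi := B.indicator f with hfi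
  set fo := Bᶜ.indicator f with hfo
  have hfim : Measurable fi := hfm.indicator hBm
  have hfom : Measurable fo := hfm.indicator hBm.compl
  have hsum : f = fi + fo := (Set.indicator_self_add_compl B f).symm
  have hai : Admissible fi := hfa.mono hfim (Set.indicator_le_self _ _)
  have hao : Admissible fo := hfa.mono hfom (Set.indicator_le_self _ _)
  have hmi : ∫⁻ x, fi x = ∫⁻ x in B, f x := lintegral_indicator hBm _
  -- Outside the ball the inner charge acts as a point charge of size at least Z.
  have hpot : ∀ x, fo x * (kern x * ENNReal.ofReal Z) ≤ fo x * potential fi x := by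
    intro x
    by_cases hx : x ∈ B
    · simp [hfo, hx]
    have hx' : r < ‖x‖ := by simpa [hB] using hx
    have hfi' : fi = fun y => (Set.Iic r).indicator k ‖y‖ := by
      funext y
      simp only [hfi, hB, hf, Set.indicator, mem_closedBall_zero_iff, Set.mem_Iic]
    have hN := potential_radial (hk.indicator measurableSet_Iic) (x := x) (k := (Set.Iic r).indicator k)
      fun s hs => Set.indicator_of_notMem (by simp only [Set.mem_Iic, not_le]; linarith) _
    rw [← hfi', hmi] at hN
    rw [hN]
    gcongr
  have hinter : ENNReal.ofReal Z * attr fo ≤ inter fi fo := by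
    rw [inter_comm hfim hfom]
    unfold attr inter
    rw [← lintegral_const_mul _ (by fun_prop)]
    refine lintegral_mono fun x => le_trans (le_of_eq ?_) (hpot x)
    ring
  have hiot : inter fi fo ≠ ∞ := ne_top_of_le_ne_top hfa.inter_ne_top
    (inter_mono (Set.indicator_le_self _ _) (Set.indicator_le_self _ _))
  have hle : tfEnergy γ Z f ≤ tfEnergy γ Z fi := by
    rw [← tfEnergy_congr γ Z hfk]
    refine h.le_tfEnergy hai ?_
    rw [hmi]
    exact (setLIntegral_le_lintegral _ _).trans (hmf ▸ h.1.2)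
  have e1 : (kin f).toReal = (kin fi).toReal + (kin fo).toReal := by
    rw [kin_eq_indicator_add hBm, ENNReal.toReal_add hai.kin_ne_top hao.kin_ne_top]
  have e2 : (attr f).toReal = (attr fi).toReal + (attr fo).toReal := by
    rw [hsum, attr_add hfim, ENNReal.toReal_add (attr_ne_top hai) (attr_ne_top hao)]
  have e3 : (inter f f).toReal
      = (inter fi fi).toReal + 2 * (inter fi fo).toReal + (inter fo fo).toReal := by
    rw [hsum, inter_add_add hfim hfom, ENNReal.toReal_add (ENNReal.add_ne_top.2
      ⟨hai.inter_ne_top, ENNReal.mul_ne_top (by simp) hiot⟩) hao.inter_ne_top,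
      ENNReal.toReal_add hai.inter_ne_top (ENNReal.mul_ne_top (by simp) hiot), ENNReal.toReal_mul]
    simp
  have e4 : Z * (attr fo).toReal ≤ (inter fi fo).toReal := by
    have := ENNReal.toReal_mono hiot hinter
    rwa [ENNReal.toReal_mul, ENNReal.toReal_ofReal hZ] at this
  -- Dropping `fo` respects the mass constraint. Its attraction is outweighed by the cross term and
  -- its self-interaction is nonnegative, so minimality leaves no room for kinetic energy.
  have hk0 : (kin fo).toReal ≤ 0 := by
    unfold tfEnergy at hle
    rw [e1, e2, e3] at hle
    have : 0 ≤ (inter fo fo).toReal := ENNReal.toReal_nonneg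
    have h5 : 3 / 5 * γ * (kin fo).toReal ≤ 0 := by linarith
    exact nonpos_of_mul_nonpos_right h5 (by positivity)
  have hk0' : kin fo = 0 := by
    have := le_antisymm hk0 ENNReal.toReal_nonneg
    exact (ENNReal.toReal_eq_zero_iff _).1 this |>.resolve_right hao.kin_ne_top
  have hfo0 : fo =ᵐ[volume] 0 := by
    filter_upwards [(lintegral_eq_zero_iff (hfom.pow_const _)).1 hk0'] with x hx
    have : fo x ^ (5 / 3 : ℝ) = 0 := hx
    exact (ENNReal.rpow_eq_zero_iff_of_pos (by norm_num)).1 this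
  have hout : ∫⁻ x in Bᶜ, f x = 0 := by
    rw [← lintegral_indicator hBm.compl, lintegral_congr_ae hfo0]
    simp
  have := lintegral_add_compl f (μ := volume) hBm
  rw [hout, add_zero] at this
  exact hr2.ne this

/-! ### Lower bound on the mass: adding a uniformly charged ball -/

/-- Bernoulli's inequality, that is, the tangent of t^(5/3) at a + b, gives the bound with b (a +
b)^(2/3); subadditivity of t^(2/3) then splits it. -/
lemma add_rpow_five_thirds_le (a b : ℝ≥0∞) : (a + b) ^ (5 / 3 : ℝ)
    ≤ a ^ (5 / 3 : ℝ) + 5 / 3 * (b * a ^ (2 / 3 : ℝ) + b ^ (5 / 3 : ℝ)) := by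
  rcases eq_or_ne a ∞ with ha | ha
  · simp [ha]
  rcases eq_or_ne b ∞ with hb | hb
  · have h53 : (5 / 3 : ℝ≥0∞) ≠ 0 := by simp
    simp [hb, ENNReal.mul_top h53]
  have hreal : ∀ a b : ℝ, 0 ≤ a → 0 ≤ b → (a + b) ^ (5 / 3 : ℝ)
      ≤ a ^ (5 / 3 : ℝ) + 5 / 3 * (b * a ^ (2 / 3 : ℝ) + b ^ (5 / 3 : ℝ)) := by
    intro a b ha hb
    rcases eq_or_lt_of_le (add_nonneg ha hb) with h0 | h0
    · rw [← h0, Real.zero_rpow (by norm_num)]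
      positivity
    have hB := one_add_mul_self_le_rpow_one_add (s := -(b / (a + b))) (p := 5 / 3)
      (by rw [neg_le_neg_iff, div_le_one h0]; linarith) (by norm_num)
    have e : 1 + -(b / (a + b)) = a / (a + b) := by field_simp; ring
    have hp : 0 < (a + b) ^ (5 / 3 : ℝ) := by positivity
    rw [e, Real.div_rpow ha h0.le, le_div_iff₀ hp] at hB
    have h53 : (a + b) ^ (5 / 3 : ℝ) = (a + b) * (a + b) ^ (2 / 3 : ℝ) := by
      rw [show (5 / 3 : ℝ) = 1 + 2 / 3 by norm_num, Real.rpow_add h0, Real.rpow_one]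
    have hb53 : b ^ (5 / 3 : ℝ) = b * b ^ (2 / 3 : ℝ) := by
      rw [show (5 / 3 : ℝ) = 1 + 2 / 3 by norm_num, Real.rpow_add' hb (by norm_num), Real.rpow_one]
    have h23 : (a + b) ^ (2 / 3 : ℝ) ≤ a ^ (2 / 3 : ℝ) + b ^ (2 / 3 : ℝ) :=
      Real.rpow_add_le_add_rpow ha hb (by norm_num) (by norm_num)
    have h1 : (1 + 5 / 3 * -(b / (a + b))) * (a + b) ^ (5 / 3 : ℝ)
        = (a + b) ^ (5 / 3 : ℝ) - 5 / 3 * (b * (a + b) ^ (2 / 3 : ℝ)) := by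
      rw [h53]; field_simp; ring
    rw [h1] at hB
    have h2 := mul_le_mul_of_nonneg_left h23 hb
    rw [hb53]
    linarith
  have h := ENNReal.ofReal_le_ofReal (hreal a.toReal b.toReal ENNReal.toReal_nonneg
    ENNReal.toReal_nonneg)
  have ha0 := ENNReal.toReal_nonneg (a := a)
  have hb0 := ENNReal.toReal_nonneg (a := b)
  rw [ENNReal.ofReal_add (by positivity) (by positivity), ENNReal.ofReal_mul (by norm_num),
    ENNReal.ofReal_add (by positivity) (by positivity), ENNReal.ofReal_mul hb0,
    ← ENNReal.ofReal_rpow_of_nonneg (by positivity) (by norm_num),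
    ← ENNReal.ofReal_rpow_of_nonneg (by positivity) (by norm_num),
    ← ENNReal.ofReal_rpow_of_nonneg (by positivity) (by norm_num),
    ← ENNReal.ofReal_rpow_of_nonneg (by positivity) (by norm_num),
    ENNReal.ofReal_add ha0 hb0, ENNReal.ofReal_toReal ha, ENNReal.ofReal_toReal hb,
    ENNReal.ofReal_div_of_pos (by norm_num)] at h
  simpa using h

/-- A uniformly charged ball. -/
noncomputable def ballFun (ε R : ℝ) : Space → ℝ≥0∞ :=
  (Metric.ball (0 : Space) R).indicator fun _ => ENNReal.ofReal ε

lemma measurable_ballFun (ε R : ℝ) : Measurable (ballFun ε R) :=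
  measurable_const.indicator measurableSet_ball

lemma lintegral_ballFun (ε R : ℝ) :
    ∫⁻ x, ballFun ε R x = ENNReal.ofReal ε * volume (Metric.ball (0 : Space) R) := by
  rw [ballFun, lintegral_indicator measurableSet_ball]
  simp

lemma lintegral_ballFun_mul (ε R : ℝ) {φ : Space → ℝ≥0∞} (hφ : Measurable φ) :
    ∫⁻ x, ballFun ε R x * φ x = ENNReal.ofReal ε * ∫⁻ x in Metric.ball (0 : Space) R, φ x := by
  rw [← lintegral_const_mul _ hφ, ← lintegral_indicator measurableSet_ball]
  refine lintegral_congr fun x => ?_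
  by_cases hx : x ∈ Metric.ball (0 : Space) R <;> simp only [ballFun, Set.indicator, hx] <;> simp

lemma attr_ballFun (ε R : ℝ) : attr (ballFun ε R) = ENNReal.ofReal ε * ballPot R :=
  lintegral_ballFun_mul ε R measurable_kern

lemma potential_ballFun_le (ε R : ℝ) (x : Space) :
    potential (ballFun ε R) x ≤ ENNReal.ofReal ε * ballPot R := by
  unfold potential
  rw [lintegral_ballFun_mul ε R (by fun_prop)]
  gcongr
  exact setLIntegral_ball_kern_le x R

lemma inter_ballFun_le (f : Space → ℝ≥0∞) (hf : Measurable f) (ε R : ℝ) :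
    inter f (ballFun ε R) ≤ (∫⁻ x, f x) * (ENNReal.ofReal ε * ballPot R) := by
  rw [← lintegral_mul_const _ hf]
  exact lintegral_mono fun x => mul_le_mul_right (potential_ballFun_le ε R x) _

/-- Hölder with exponents 3/2 and 3 bounds the integral of f^(2/3) over the ball, so the term linear
in ε grows only like R. -/
lemma kin_add_ballFun_le {f : Space → ℝ≥0∞} (hf : Measurable f) {ε : ℝ} (hε : 0 ≤ ε) (R : ℝ) :
    kin (f + ballFun ε R) ≤ kin f + 5 / 3 * (ENNReal.ofReal ε * ((∫⁻ x, f x) ^ (2 / 3 : ℝ) *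
      volume (Metric.ball (0 : Space) R) ^ (1 / 3 : ℝ)) +
      ENNReal.ofReal (ε ^ (5 / 3 : ℝ)) * volume (Metric.ball (0 : Space) R)) := by
  have hg := measurable_ballFun ε R
  have hH : ∫⁻ x in Metric.ball (0 : Space) R, f x ^ (2 / 3 : ℝ) ≤ (∫⁻ x, f x) ^ (2 / 3 : ℝ) *
      volume (Metric.ball (0 : Space) R) ^ (1 / 3 : ℝ) := by
    have hpq : (3 / 2 : ℝ).HolderConjugate 3 := by rw [Real.holderConjugate_iff]; norm_num
    have := ENNReal.lintegral_mul_le_Lp_mul_Lq (volume.restrict (Metric.ball (0 : Space) R)) hpq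
      (f := fun x => f x ^ (2 / 3 : ℝ)) (g := fun _ => 1) (hf.pow_const _).aemeasurable
      aemeasurable_const
    simp only [Pi.mul_apply, mul_one, ENNReal.one_rpow, lintegral_const, one_mul,
      Measure.restrict_apply_univ, ← ENNReal.rpow_mul] at this
    norm_num at this
    norm_num
    refine this.trans ?_
    gcongr
    exact Measure.restrict_le_self
  have hb53 : ∫⁻ x, ballFun ε R x ^ (5 / 3 : ℝ)
      = ENNReal.ofReal (ε ^ (5 / 3 : ℝ)) * volume (Metric.ball (0 : Space) R) := by
    rw [← setLIntegral_const, ← lintegral_indicator measurableSet_ball]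
    refine lintegral_congr fun x => ?_
    by_cases hx : x ∈ Metric.ball (0 : Space) R <;> simp only [ballFun, Set.indicator, hx]
    · simp only [if_true]
      rw [ENNReal.ofReal_rpow_of_nonneg hε (by norm_num)]
    · simp
  unfold kin
  calc ∫⁻ x, (f + ballFun ε R) x ^ (5 / 3 : ℝ)
      ≤ ∫⁻ x, (f x ^ (5 / 3 : ℝ) + 5 / 3 * (ballFun ε R x * f x ^ (2 / 3 : ℝ) +
        ballFun ε R x ^ (5 / 3 : ℝ))) := lintegral_mono fun x => add_rpow_five_thirds_le _ _
    _ = (∫⁻ x, f x ^ (5 / 3 : ℝ)) + 5 / 3 * (ENNReal.ofReal ε *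
        (∫⁻ x in Metric.ball (0 : Space) R, f x ^ (2 / 3 : ℝ)) +
        ENNReal.ofReal (ε ^ (5 / 3 : ℝ)) * volume (Metric.ball (0 : Space) R)) := by
        rw [lintegral_add_left (by fun_prop), lintegral_const_mul _ (by fun_prop),
          lintegral_add_left (by fun_prop), lintegral_ballFun_mul ε R (by fun_prop), hb53]
    _ ≤ _ := by gcongr

lemma kin_add_ballFun_ne_top {f : Space → ℝ≥0∞} (hf : Measurable f) (hk : kin f ≠ ∞)
    (hm : ∫⁻ x, f x ≠ ∞) {ε : ℝ} (hε : 0 ≤ ε) (R : ℝ) : kin (f + ballFun ε R) ≠ ∞ := by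
  have hv : volume (Metric.ball (0 : Space) R) ≠ ∞ := measure_ball_lt_top.ne
  refine ne_top_of_le_ne_top (ENNReal.add_ne_top.2 ⟨hk, ENNReal.mul_ne_top
    (ENNReal.div_ne_top (by simp) (by simp)) (ENNReal.add_ne_top.2 ⟨?_, ?_⟩)⟩)
    (kin_add_ballFun_le hf hε R)
  · exact ENNReal.mul_ne_top ENNReal.ofReal_ne_top (ENNReal.mul_ne_top
      (ENNReal.rpow_ne_top_of_nonneg (by norm_num) hm)
      (ENNReal.rpow_ne_top_of_nonneg (by norm_num) hv))
  · exact ENNReal.mul_ne_top ENNReal.ofReal_ne_top hv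

lemma Admissible.add_ballFun {f : Space → ℝ≥0∞} (hf : Admissible f) (hm : ∫⁻ x, f x ≠ ∞)
    {ε : ℝ} (hε : 0 ≤ ε) (R : ℝ) : Admissible (f + ballFun ε R) := by
  have hg := measurable_ballFun ε R
  have hJ : ENNReal.ofReal ε * ballPot R ≠ ∞ :=
    ENNReal.mul_ne_top ENNReal.ofReal_ne_top (ballPot_ne_top R)
  have hgm : ∫⁻ x, ballFun ε R x ≠ ∞ := by
    rw [lintegral_ballFun]; exact ENNReal.mul_ne_top ENNReal.ofReal_ne_top measure_ball_lt_top.ne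
  refine ⟨hf.measurable.add hg, kin_add_ballFun_ne_top hf.measurable hf.kin_ne_top hm hε R, ?_⟩
  rw [inter_add_add hf.measurable hg]
  refine ENNReal.add_ne_top.2 ⟨ENNReal.add_ne_top.2 ⟨hf.inter_ne_top, ENNReal.mul_ne_top (by simp)
    ?_⟩, ?_⟩
  · exact ne_top_of_le_ne_top (ENNReal.mul_ne_top hm hJ) (inter_ballFun_le f hf.measurable ε R)
  · exact ne_top_of_le_ne_top (ENNReal.mul_ne_top hgm hJ) (inter_ballFun_le _ hg ε R)

/-- The energy cost of adding a uniformly charged ball. -/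
lemma tfEnergy_add_ballFun_le {γ Z : ℝ} (hγ : 0 < γ) {f : Space → ℝ≥0∞} (hf : Admissible f)
    (hm : ∫⁻ x, f x ≠ ∞) {ε : ℝ} (hε : 0 ≤ ε) (R : ℝ) {m v J : ℝ}
    (hm' : m = (∫⁻ x, f x).toReal) (hv' : v = (volume (Metric.ball (0 : Space) R)).toReal)
    (hJ' : J = (ballPot R).toReal) :
    tfEnergy γ Z (f + ballFun ε R) ≤ tfEnergy γ Z f +
      γ * (ε * (m ^ (2 / 3 : ℝ) * v ^ (1 / 3 : ℝ)) + ε ^ (5 / 3 : ℝ) * v)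
      - (Z - m) * (ε * J) + ε * v * (ε * J) / 2 := by
  have hg := measurable_ballFun ε R
  have hv : volume (Metric.ball (0 : Space) R) ≠ ∞ := measure_ball_lt_top.ne
  have hJ : ENNReal.ofReal ε * ballPot R ≠ ∞ :=
    ENNReal.mul_ne_top ENNReal.ofReal_ne_top (ballPot_ne_top R)
  have hgm : ∫⁻ x, ballFun ε R x ≠ ∞ := by
    rw [lintegral_ballFun]; exact ENNReal.mul_ne_top ENNReal.ofReal_ne_top hv
  have i1 := inter_ballFun_le f hf.measurable ε R
  have i2 := inter_ballFun_le _ hg ε R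
  have i1t := ne_top_of_le_ne_top (ENNReal.mul_ne_top hm hJ) i1
  have i2t := ne_top_of_le_ne_top (ENNReal.mul_ne_top hgm hJ) i2
  have t1 := ENNReal.toReal_mono (ENNReal.mul_ne_top hm hJ) i1
  have t2 := ENNReal.toReal_mono (ENNReal.mul_ne_top hgm hJ) i2
  rw [lintegral_ballFun] at t2
  simp only [ENNReal.toReal_mul, ENNReal.toReal_ofReal hε, ← hm', ← hv', ← hJ'] at t1 t2
  have e3 : (inter (f + ballFun ε R) (f + ballFun ε R)).toReal = (inter f f).toReal +
      2 * (inter f (ballFun ε R)).toReal + (inter (ballFun ε R) (ballFun ε R)).toReal := by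
    rw [inter_add_add hf.measurable hg, ENNReal.toReal_add (ENNReal.add_ne_top.2
      ⟨hf.inter_ne_top, ENNReal.mul_ne_top (by simp) i1t⟩) i2t,
      ENNReal.toReal_add hf.inter_ne_top (ENNReal.mul_ne_top (by simp) i1t), ENNReal.toReal_mul]
    simp
  have e2 : (attr (f + ballFun ε R)).toReal = (attr f).toReal + ε * J := by
    rw [attr_add hf.measurable, attr_ballFun, ENNReal.toReal_add (attr_ne_top hf) hJ,
      ENNReal.toReal_mul, ENNReal.toReal_ofReal hε, hJ']
  have a1 : ENNReal.ofReal ε * ((∫⁻ x, f x) ^ (2 / 3 : ℝ) *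
      volume (Metric.ball (0 : Space) R) ^ (1 / 3 : ℝ)) ≠ ∞ :=
    ENNReal.mul_ne_top ENNReal.ofReal_ne_top (ENNReal.mul_ne_top
      (ENNReal.rpow_ne_top_of_nonneg (by norm_num) hm)
      (ENNReal.rpow_ne_top_of_nonneg (by norm_num) hv))
  have a2 : ENNReal.ofReal (ε ^ (5 / 3 : ℝ)) * volume (Metric.ball (0 : Space) R) ≠ ∞ :=
    ENNReal.mul_ne_top ENNReal.ofReal_ne_top hv
  have a3 : (5 / 3 : ℝ≥0∞) ≠ ∞ := ENNReal.div_ne_top (by simp) (by simp)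
  have e1 := ENNReal.toReal_mono (ENNReal.add_ne_top.2 ⟨hf.kin_ne_top, ENNReal.mul_ne_top a3
    (ENNReal.add_ne_top.2 ⟨a1, a2⟩)⟩) (kin_add_ballFun_le hf.measurable hε R)
  rw [ENNReal.toReal_add hf.kin_ne_top (ENNReal.mul_ne_top a3 (ENNReal.add_ne_top.2 ⟨a1, a2⟩)),
    ENNReal.toReal_mul, ENNReal.toReal_add a1 a2] at e1
  simp only [ENNReal.toReal_mul, ENNReal.toReal_ofReal hε, ← ENNReal.toReal_rpow,
    ENNReal.toReal_ofReal (Real.rpow_nonneg hε (5 / 3)), ← hm', ← hv', ENNReal.toReal_div,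
    ENNReal.toReal_ofNat] at e1
  have e1' := mul_le_mul_of_nonneg_left e1 (show 0 ≤ 3 / 5 * γ by positivity)
  unfold tfEnergy
  rw [e2, e3]
  linarith

lemma volume_ball_toReal {R : ℝ} (hR : 0 ≤ R) : (volume (Metric.ball (0 : Space) R)).toReal
    = R ^ 3 * (volume (Metric.ball (0 : Space) 1)).toReal := by
  rw [volume_ball_eq hR, ENNReal.toReal_mul, ENNReal.toReal_ofReal (by positivity)]

lemma volume_unitBall_pos : 0 < (volume (Metric.ball (0 : Space) 1)).toReal :=
  ENNReal.toReal_pos (Metric.measure_ball_pos _ _ one_pos).ne' measure_ball_lt_top.ne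

/-- A minimizer at bounded mass whose mass constraint is not active is at least neutral. -/
lemma IsMinimizer.le_mass {γ Z N : ℝ} (hγ : 0 < γ) {ρ : Density}
    (h : IsMinimizer γ Z (admissibleLE N) ρ) (hN : mass ρ < ENNReal.ofReal N) :
    ENNReal.ofReal Z ≤ mass ρ := by
  by_contra! hcon
  have ha := (mem_admissible_iff.1 h.1.1).2
  have hmt : mass ρ ≠ ∞ := hcon.ne_top
  set m := (mass ρ).toReal with hm
  have hm0 : 0 ≤ m := ENNReal.toReal_nonneg
  have hmZ : m < Z := (ENNReal.lt_ofReal_iff_toReal_lt hmt).1 hcon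
  have hmN : m < N := (ENNReal.lt_ofReal_iff_toReal_lt hmt).1 hN
  set c := (volume (Metric.ball (0 : Space) 1)).toReal with hc
  have hc0 : 0 < c := volume_unitBall_pos
  set q := γ * (m ^ (2 / 3 : ℝ) * c ^ (1 / 3 : ℝ)) with hq
  have hq0 : 0 ≤ q := by positivity
  -- The gain per unit of ε is at least (Z - m) c R² = (q + 1) R for this R, while the kinetic cost
  -- is q R.
  set R : ℝ := (q + 1) / ((Z - m) * c) with hR
  have hZm : 0 < Z - m := by linarith
  have hR0 : 0 < R := by positivity
  set v := (volume (Metric.ball (0 : Space) R)).toReal with hv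
  have hvR : v = R ^ 3 * c := volume_ball_toReal hR0.le
  have hv0 : 0 < v := by rw [hvR]; positivity
  set J := (ballPot R).toReal with hJ
  have hJ0 : 0 ≤ J := ENNReal.toReal_nonneg
  have hJv : R ^ 2 * c ≤ J := by
    have := ENNReal.toReal_mono (ballPot_ne_top R) (volume_ball_div_le_ballPot R)
    rw [ENNReal.toReal_mul, ENNReal.toReal_inv, ENNReal.toReal_ofReal hR0.le, ← hv, hvR] at this
    refine le_trans (le_of_eq ?_) this
    field_simp
  have hv3 : v ^ (1 / 3 : ℝ) = R * c ^ (1 / 3 : ℝ) := by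
    rw [hvR, Real.mul_rpow (by positivity) hc0.le, ← Real.rpow_natCast, ← Real.rpow_mul hR0.le]
    norm_num
  have hgap : 0 < (Z - m) * J - γ * (m ^ (2 / 3 : ℝ) * v ^ (1 / 3 : ℝ)) := by
    have h1 : γ * (m ^ (2 / 3 : ℝ) * v ^ (1 / 3 : ℝ)) = q * R := by rw [hv3, hq]; ring
    have h2 : (Z - m) * (R ^ 2 * c) = (q + 1) * R := by rw [hR]; field_simp
    have h3 := mul_le_mul_of_nonneg_left hJv hZm.le
    rw [h1]
    linarith
  -- These are the terms of higher order in ε, divided by ε.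
  have hlim : Filter.Tendsto (fun ε : ℝ => γ * (ε ^ (2 / 3 : ℝ) * v) + ε * (v * J) / 2)
      (nhdsWithin 0 (Set.Ioi 0)) (nhds 0) := by
    have hcont : Continuous fun ε : ℝ => γ * (ε ^ (2 / 3 : ℝ) * v) + ε * (v * J) / 2 := by
      have : Continuous fun ε : ℝ => ε ^ (2 / 3 : ℝ) := Real.continuous_rpow_const (by norm_num)
      fun_prop
    have := (hcont.tendsto 0).mono_left (nhdsWithin_le_nhds (s := Set.Ioi (0:ℝ)))
    simpa [Real.zero_rpow] using this
  have hlim2 : Filter.Tendsto (fun ε : ℝ => ε * v) (nhdsWithin 0 (Set.Ioi 0)) (nhds 0) := by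
    have := ((continuous_mul_const v).tendsto 0).mono_left
      (nhdsWithin_le_nhds (s := Set.Ioi (0:ℝ)))
    simpa using this
  obtain ⟨ε, ⟨h1, h2⟩, hε⟩ := (((hlim.eventually (gt_mem_nhds hgap)).and
    (hlim2.eventually (gt_mem_nhds (show 0 < N - m by linarith)))).and self_mem_nhdsWithin).exists
  have hε : 0 < ε := hε
  have hA := ha.add_ballFun (f := dens ρ) hmt hε.le R
  have hle := h.le_tfEnergy hA (by
    have : ∫⁻ x, (dens ρ + ballFun ε R) x = mass ρ + ENNReal.ofReal ε *
        volume (Metric.ball (0 : Space) R) := by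
      rw [← lintegral_ballFun, mass, ← lintegral_add_right _ (measurable_ballFun ε R)]
      rfl
    rw [this, ← ENNReal.ofReal_toReal hmt, ← ENNReal.ofReal_toReal
      (measure_ball_lt_top (μ := (volume : Measure Space)) (x := 0) (r := R)).ne,
      ← ENNReal.ofReal_mul hε.le, ← ENNReal.ofReal_add hm0 (by positivity)]
    refine ENNReal.ofReal_le_ofReal ?_
    linarith)
  have hE := tfEnergy_add_ballFun_le (Z := Z) hγ ha hmt hε.le R hm hv hJ
  have h53 : ε ^ (5 / 3 : ℝ) = ε * ε ^ (2 / 3 : ℝ) := by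
    rw [show (5 / 3 : ℝ) = 1 + 2 / 3 by norm_num, Real.rpow_add hε, Real.rpow_one]
  rw [h53] at hE
  have h4 := mul_lt_mul_of_pos_left h1 hε
  nlinarith

/-! ### Charge spread to infinity, and densities of infinite mass -/

/-- Spreading additional charge costs arbitrarily little energy at neutrality. -/
lemma exists_tfEnergy_add_ballFun_lt {γ Z : ℝ} (hγ : 0 < γ) {f : Space → ℝ≥0∞}
    (hf : Admissible f) (hm : ∫⁻ x, f x = ENNReal.ofReal Z) (hZ : 0 ≤ Z) {a : ℝ} (ha : 0 ≤ a)
    {η : ℝ} (hη : 0 < η) :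
    ∃ g, Admissible g ∧ ∫⁻ x, g x = ENNReal.ofReal (Z + a) ∧
      tfEnergy γ Z g < tfEnergy γ Z f + η := by
  have hmt : ∫⁻ x, f x ≠ ∞ := by rw [hm]; exact ENNReal.ofReal_ne_top
  have hmZ : Z = (∫⁻ x, f x).toReal := by rw [hm, ENNReal.toReal_ofReal hZ]
  set c := (volume (Metric.ball (0 : Space) 1)).toReal with hc
  have hc0 : 0 < c := volume_unitBall_pos
  set v : ℝ → ℝ := fun R => (volume (Metric.ball (0 : Space) R)).toReal with hv
  have hvtop : Filter.Tendsto v Filter.atTop Filter.atTop := by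
    have h1 : Filter.Tendsto (fun R : ℝ => R ^ 3 * c) Filter.atTop Filter.atTop :=
      (Filter.tendsto_pow_atTop (by norm_num)).atTop_mul_const hc0
    refine h1.congr' ?_
    filter_upwards [Filter.eventually_ge_atTop 0] with R hR
    exact (volume_ball_toReal hR).symm
  have hvinv : Filter.Tendsto (fun R => (v R)⁻¹) Filter.atTop (nhds 0) := hvtop.inv_tendsto_atTop
  have hrp : ∀ s : ℝ, 0 < s → Filter.Tendsto (fun R => ((v R)⁻¹) ^ s) Filter.atTop (nhds 0) := by
    intro s hs
    have := ((Real.continuous_rpow_const hs.le).tendsto 0).comp hvinv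
    rw [Real.zero_rpow hs.ne'] at this
    exact this
  have hJ : Filter.Tendsto (fun R => (ballPot R).toReal * (v R)⁻¹) Filter.atTop (nhds 0) := by
    refine Metric.tendsto_nhds.2 fun τ hτ => ?_
    -- Then s⁻¹ = τ/2, which bounds the share of the region beyond s; the share of the ball of
    -- radius s vanishes as R grows.
    set s : ℝ := 2 / τ with hs
    have hs0 : 0 < s := by positivity
    have h1 : Filter.Tendsto (fun R => (ballPot s).toReal * (v R)⁻¹) Filter.atTop (nhds 0) := by
      simpa using hvinv.const_mul (ballPot s).toReal
    filter_upwards [h1.eventually (gt_mem_nhds (show 0 < τ / 2 by positivity)),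
      hvtop.eventually_gt_atTop 0] with R h2 h3
    rw [Real.dist_eq, sub_zero, abs_of_nonneg (by positivity)]
    have h4 := ENNReal.toReal_mono (ENNReal.add_ne_top.2 ⟨ballPot_ne_top s, ENNReal.mul_ne_top
      measure_ball_lt_top.ne (by simpa using hs0)⟩) (ballPot_le R s)
    rw [ENNReal.toReal_add (ballPot_ne_top s) (ENNReal.mul_ne_top
      measure_ball_lt_top.ne (by simpa using hs0)), ENNReal.toReal_mul, ENNReal.toReal_inv,
      ENNReal.toReal_ofReal hs0.le] at h4
    change _ ≤ (ballPot s).toReal + v R * s⁻¹ at h4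
    have h5 := mul_le_mul_of_nonneg_right h4 (inv_nonneg.2 h3.le)
    have h6 : ((ballPot s).toReal + v R * s⁻¹) * (v R)⁻¹ = (ballPot s).toReal * (v R)⁻¹ + τ / 2 := by
      rw [hs]; field_simp
    linarith
  -- This is the cost with ε = a / v R. At neutrality the term with factor Z - m is absent, so every
  -- remaining term decays.
  have hlim : Filter.Tendsto (fun R => γ * (a * Z ^ (2 / 3 : ℝ) * ((v R)⁻¹) ^ (2 / 3 : ℝ) +
      a ^ (5 / 3 : ℝ) * ((v R)⁻¹) ^ (2 / 3 : ℝ)) + a * a * ((ballPot R).toReal * (v R)⁻¹) / 2)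
      Filter.atTop (nhds 0) := by
    have h23 := hrp (2 / 3) (by norm_num)
    have := (((h23.const_mul (a * Z ^ (2 / 3 : ℝ))).add (h23.const_mul (a ^ (5 / 3 : ℝ)))).const_mul
      γ).add ((hJ.const_mul (a * a)).div_const 2)
    simpa using this
  obtain ⟨R, hR1, hR2⟩ := ((hlim.eventually (gt_mem_nhds hη)).and
    (hvtop.eventually_gt_atTop 0)).exists
  set w := v R with hw
  set ε := a / w with hε
  have hε0 : 0 ≤ ε := by positivity
  have hεw : ε * w = a := by rw [hε]; field_simp
  refine ⟨f + ballFun ε R, hf.add_ballFun hmt hε0 R, ?_, ?_⟩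
  · have : ∫⁻ x, (f + ballFun ε R) x = (∫⁻ x, f x) + ENNReal.ofReal ε *
        volume (Metric.ball (0 : Space) R) := by
      rw [← lintegral_ballFun, ← lintegral_add_right _ (measurable_ballFun ε R)]
      rfl
    rw [this, hm, ← ENNReal.ofReal_toReal
      (measure_ball_lt_top (μ := (volume : Measure Space)) (x := 0) (r := R)).ne,
      ← ENNReal.ofReal_mul hε0, ← ENNReal.ofReal_add hZ (by positivity)]
    congr 2
  · have hE := tfEnergy_add_ballFun_le (Z := Z) hγ hf hmt hε0 R hmZ hw rfl
    have h1 : ε * (Z ^ (2 / 3 : ℝ) * w ^ (1 / 3 : ℝ)) = a * Z ^ (2 / 3 : ℝ) * w⁻¹ ^ (2 / 3 : ℝ) := by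
      have : w⁻¹ * w ^ (1 / 3 : ℝ) = w⁻¹ ^ (2 / 3 : ℝ) := by
        rw [Real.inv_rpow hR2.le, ← Real.rpow_neg hR2.le, ← Real.rpow_neg_one w,
          ← Real.rpow_add hR2]
        norm_num
      rw [← this, hε]; ring
    have h2 : ε ^ (5 / 3 : ℝ) * w = a ^ (5 / 3 : ℝ) * w⁻¹ ^ (2 / 3 : ℝ) := by
      have : w⁻¹ ^ (5 / 3 : ℝ) * w = w⁻¹ ^ (2 / 3 : ℝ) := by
        rw [show (5 / 3 : ℝ) = 2 / 3 + 1 by norm_num, Real.rpow_add (inv_pos.2 hR2), Real.rpow_one,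
          mul_assoc, inv_mul_cancel₀ hR2.ne', mul_one]
      rw [← this, hε, div_eq_mul_inv, Real.mul_rpow ha (by positivity)]; ring
    have h3 : ε * w * (ε * (ballPot R).toReal) / 2 = a * a * ((ballPot R).toReal * w⁻¹) / 2 := by
      rw [hεw, hε]; ring
    rw [h1, h2, h3] at hE
    linarith

/-- Lower bounds at finite mass extend to all admissible densities. -/
lemma le_tfEnergy_of_finite_mass {γ Z e : ℝ} (hγ : 0 < γ)
    (h : ∀ f, Admissible f → ∫⁻ x, f x ≠ ∞ → e ≤ tfEnergy γ Z f) {f : Space → ℝ≥0∞}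
    (hf : Admissible f) : e ≤ tfEnergy γ Z f := by
  set B : ℕ → Set Space := fun n => Metric.closedBall 0 n with hB
  have hBm : ∀ n, MeasurableSet (B n) := fun n => measurableSet_closedBall
  have hle : ∀ n, (B n).indicator f ≤ f := fun n => Set.indicator_le_self _ _
  have hadm : ∀ n, Admissible ((B n).indicator f) := fun n =>
    hf.mono (hf.measurable.indicator (hBm n)) (hle n)
  have hattr : ∀ n, attr ((B n).indicator f) = (volume.withDensity fun x => f x * kern x) (B n) := by
    intro n
    rw [withDensity_apply _ (hBm n), ← lintegral_indicator (hBm n)]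
    refine lintegral_congr fun x => ?_
    by_cases hx : x ∈ B n <;> simp [hx]
  have hU : ⋃ n, B n = Set.univ := by
    refine Set.eq_univ_of_forall fun x => Set.mem_iUnion.2 ?_
    obtain ⟨n, hn⟩ := exists_nat_ge ‖x‖
    exact ⟨n, by simpa [hB] using hn⟩
  have hlim : Filter.Tendsto (fun n => attr ((B n).indicator f)) Filter.atTop (nhds (attr f)) := by
    simp_rw [hattr]
    have := tendsto_measure_iUnion_atTop (μ := volume.withDensity fun x => f x * kern x)
      (s := B) fun i j hij => Metric.closedBall_subset_closedBall (by exact_mod_cast hij)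
    rwa [hU, withDensity_apply _ MeasurableSet.univ, setLIntegral_univ] at this
  have hlim' := (ENNReal.tendsto_toReal (attr_ne_top hf)).comp hlim
  -- Truncation only decreases the kinetic and Coulomb terms, so these are kept at full value; only
  -- the attraction has to converge.
  refine ge_of_tendsto' (x := Filter.atTop) (f := fun n : ℕ => 3 / 5 * γ * (kin f).toReal -
    Z * (attr ((B n).indicator f)).toReal + (inter f f).toReal / 2)
    (((hlim'.const_mul Z).const_sub _).add_const _) fun n => ?_
  have hfin : ∫⁻ x, (B n).indicator f x ≠ ∞ := by
    rw [lintegral_indicator (hBm n)]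
    have hpt : ∀ x, f x ≤ 1 + f x ^ (5 / 3 : ℝ) := by
      intro x
      rcases le_total (f x) 1 with h | h
      · exact h.trans le_self_add
      · refine le_trans ?_ le_add_self
        calc f x = f x ^ (1 : ℝ) := by simp
          _ ≤ _ := ENNReal.rpow_le_rpow_of_exponent_le h (by norm_num)
    refine ne_top_of_le_ne_top ?_ (lintegral_mono hpt)
    rw [lintegral_add_left measurable_const]
    refine ENNReal.add_ne_top.2 ⟨?_, ne_top_of_le_ne_top hf.kin_ne_top (setLIntegral_le_lintegral _ _)⟩
    rw [setLIntegral_const, one_mul]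
    exact measure_closedBall_lt_top.ne
  have h1 := h _ (hadm n) hfin
  have h2 : (kin ((B n).indicator f)).toReal ≤ (kin f).toReal :=
    ENNReal.toReal_mono hf.kin_ne_top
      (lintegral_mono fun x => ENNReal.rpow_le_rpow (hle n x) (by norm_num))
  have h3 : (inter ((B n).indicator f) ((B n).indicator f)).toReal ≤ (inter f f).toReal :=
    ENNReal.toReal_mono hf.inter_ne_top (inter_mono (hle n) (hle n))
  have h4 := mul_le_mul_of_nonneg_left h2 (show 0 ≤ 3 / 5 * γ by positivity)
  unfold tfEnergy at h1
  linarith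

/-- Either the constraint is active, or `le_mass` and `mass_le` together force neutrality. -/
lemma IsMinimizer.mass_eq {γ Z N : ℝ} (hγ : 0 < γ) (hZ : 0 ≤ Z) {ρ : Density}
    (h : IsMinimizer γ Z (admissibleLE N) ρ) : mass ρ = ENNReal.ofReal (min N Z) := by
  have h1 := h.1.2
  have h2 := h.mass_le hγ hZ
  have hmin : ENNReal.ofReal (min N Z) = min (ENNReal.ofReal N) (ENNReal.ofReal Z) :=
    ENNReal.ofReal_mono.map_min
  rw [hmin]
  refine le_antisymm (le_min h1 h2) ?_
  by_contra! hcon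
  obtain ⟨h3, h4⟩ := lt_min_iff.1 hcon
  exact absurd h4 (not_lt.2 (h.le_mass hγ h3))

end ThomasFermi

/-! ### Assembly -/

theorem mainTheorem5 (γ Z N : ℝ) (hγ : 0 < γ) (hZ : 0 ≤ Z) (hN : 0 ≤ N) :
    ∃ ρZ : ThomasFermi.Density,
      -- `ρZ` is the unique minimizer on `𝓘`
      (∀ σ, ThomasFermi.IsMinimizer γ Z ThomasFermi.admissible σ ↔ σ = ρZ) ∧
      -- for `N ≤ Z` there is a unique minimizer on `𝓘_N`, and it lies in `𝓘_{∂N}`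
      (N ≤ Z → ∃ ρ ∈ ThomasFermi.admissibleEq N,
        ∀ σ, ThomasFermi.IsMinimizer γ Z (ThomasFermi.admissibleLE N) σ ↔ σ = ρ) ∧
      -- for `N > Z` the unique minimizer on `𝓘_N` is `ρZ`, and it lies in `𝓘_{∂Z}`;
      -- there is no minimizer on `𝓘_{∂N}`, but the infima over `𝓘_N` and `𝓘_{∂N}` agree
      (Z < N →
        (∀ σ, ThomasFermi.IsMinimizer γ Z (ThomasFermi.admissibleLE N) σ ↔ σ = ρZ) ∧
        ρZ ∈ ThomasFermi.admissibleEq Z ∧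
        (¬ ∃ σ, ThomasFermi.IsMinimizer γ Z (ThomasFermi.admissibleEq N) σ) ∧
        ∃ E : ℝ,
          IsGLB (ThomasFermi.energy γ Z '' ThomasFermi.admissibleLE N) E ∧
          IsGLB (ThomasFermi.energy γ Z '' ThomasFermi.admissibleEq N) E) := by
  open ThomasFermi in
  -- Any mass bound above Z would serve.
  obtain ⟨ρZ, hρZ⟩ := exists_isMinimizer hγ hZ (Z + 1)
  have hmass : mass ρZ = ENNReal.ofReal Z := by
    rw [hρZ.mass_eq hγ hZ, min_eq_right (by linarith)]
  -- The minimizers for all bounds above Z have mass Z, so each competes in the other's problem.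
  have hmin : ∀ M, Z < M → IsMinimizer γ Z (admissibleLE M) ρZ := by
    intro M hM
    obtain ⟨ρ, hρ⟩ := exists_isMinimizer hγ hZ M
    have hm : mass ρ = ENNReal.ofReal Z := by rw [hρ.mass_eq hγ hZ, min_eq_right hM.le]
    refine ⟨⟨hρZ.1.1, hmass.trans_le (ENNReal.ofReal_le_ofReal hM.le)⟩, fun σ hσ => ?_⟩
    exact (hρZ.2 ρ ⟨hρ.1.1, hm.trans_le (ENNReal.ofReal_le_ofReal (by linarith))⟩).trans (hρ.2 σ hσ)
  have hglob : IsMinimizer γ Z admissible ρZ := by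
    refine ⟨hρZ.1.1, fun σ hσ => ?_⟩
    rw [energy_eq γ Z hσ]
    refine le_tfEnergy_of_finite_mass hγ (fun f hf hfm => ?_) (mem_admissible_iff.1 hσ).2
    rw [energy_eq γ Z hρZ.1.1]
    refine (hmin (max (Z + 1) (∫⁻ x, f x).toReal) (lt_max_of_lt_left (by linarith))).le_tfEnergy hf ?_
    rw [← ENNReal.ofReal_toReal hfm]
    exact ENNReal.ofReal_le_ofReal (le_max_of_le_right (by rw [ENNReal.ofReal_toReal hfm]))
  refine ⟨ρZ, isMinimizer_iff hγ subset_rfl midpointClosed_admissible hglob, fun hNZ => ?_,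
    fun hZN => ?_⟩
  · obtain ⟨ρ, hρ⟩ := exists_isMinimizer hγ hZ N
    exact ⟨ρ, ⟨hρ.1, by rw [hρ.mass_eq hγ hZ, min_eq_left hNZ]⟩,
      isMinimizer_iff hγ (fun _ h => h.1) (midpointClosed_admissibleLE N) hρ⟩
  · have hiff := isMinimizer_iff hγ (fun _ h => h.1) (midpointClosed_admissibleLE N) (hmin N hZN)
    have happrox : ∀ η : ℝ, 0 < η → ∃ σ ∈ admissibleEq N, energy γ Z σ < energy γ Z ρZ + η := by
      intro η hη
      obtain ⟨g, hg, hgm, hgE⟩ := exists_tfEnergy_add_ballFun_lt (Z := Z) hγ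
        (mem_admissible_iff.1 hρZ.1.1).2 hmass hZ (a := N - Z) (by linarith) hη
      obtain ⟨σ, hσ, -, hσm, hσE⟩ := exists_density_of_admissible γ Z hg
      rw [hgm, add_sub_cancel] at hσm
      exact ⟨σ, ⟨⟨hσ, hσm.le⟩, hσm⟩, by rw [hσE, energy_eq γ Z hρZ.1.1]; exact hgE⟩
    refine ⟨hiff, ⟨⟨hρZ.1.1, hmass.le⟩, hmass⟩, ?_, energy γ Z ρZ, ?_, ?_, ?_⟩
    · rintro ⟨σ, hσ, hσmin⟩
      -- As mass-N densities come arbitrarily close in energy to `ρZ`, a minimizer among them would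
      -- minimize over `admissibleLE N` and equal `ρZ`, whose mass is Z.
      have hσle : energy γ Z σ ≤ energy γ Z ρZ := by
        refine le_of_forall_pos_lt_add fun η hη => ?_
        obtain ⟨τ, hτ, hτE⟩ := happrox η hη
        exact (hσmin τ hτ).trans_lt hτE
      have hσeq : σ = ρZ := (hiff σ).1
        ⟨hσ.1, fun τ hτ => hσle.trans ((hmin N hZN).2 τ hτ)⟩
      have h1 := hσ.2
      rw [hσeq, hmass, ENNReal.ofReal_eq_ofReal_iff hZ hN] at h1
      exact hZN.ne h1
    · exact IsLeast.isGLB ⟨⟨ρZ, (hmin N hZN).1, rfl⟩, by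
        rintro _ ⟨σ, hσ, rfl⟩; exact (hmin N hZN).2 σ hσ⟩
    · rintro _ ⟨σ, hσ, rfl⟩
      exact (hmin N hZN).2 σ hσ.1
    · intro b hb
      refine le_of_forall_pos_lt_add fun η hη => ?_
      obtain ⟨τ, hτ, hτE⟩ := happrox η hη
      exact (hb ⟨τ, hτ, rfl⟩).trans_lt hτE
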